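/- Consider the two-user additive white Gaussian noise multiple-access channel $Y_t = X_{1,t}+X_{2,t}+Z_t$, where $Z_1,Z_2,\dots$ are i.i.d. centred Gaussian of variance $N$. The messages $M_1,M_2$ are independent, uniformly distributed over finite nonempty sets $\mathcal M_1,\mathcal M_2$, and independent of the noise. In the *no-feedback* setting a blocklength-$n$ code has inputs $X_{1,t}$ and $X_{2,t}$ ($1\le t\le n$) that are functions of $M_1$ and of $M_2$, respectively. In the *noisy partial feedback* setting $X_{1,t}$ is a function of $M_1$ only, while $X_{2,t}$ is a function of $(M_2,V_1,\dots,V_{t-1})$, where $V_t=Y_t+W_t$ and $W_1,W_2,\dots$ are i.i.d. centred Gaussian of variance $\sigma_2^2$, independent of $(M_1,M_2,\{Z_t\})$. In both settings the inputs satisfy the power constraints $\frac1n\sum_{t=1}^n \mathbb E[X_{\nu,t}^2]\le P_\nu$ for $\nu\in\{1,2\}$, and the decoder is a function $\phi^{(n)}:\mathbb R^n\to\mathcal M_1\times\mathcal M_2$ of $Y_1,\dots,Y_n$. A pair $(R_1,R_2)$ of nonnegative reals is achievable if for every $\delta>0$ there are, for all sufficiently large $n$, blocklength-$n$ codes with $\frac1n\log|\mathcal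 M_\nu|>R_\nu-\delta$ for $\nu\in\{1,2\}$ whose average error probability $\Pr[\phi^{(n)}(Y_1,\dots,Y_n)\ne(M_1,M_2)]$ tends to $0$ as $n\to\infty$. The capacity region is the set of all achievable pairs; write $\mathcal C_{\mathrm{MAC}}(P_1,P_2,N)$ for it in the no-feedback setting and $\mathcal C_{\mathrm{NoisyPartialFB}}(P_1,P_2,N,\sigma_2^2)$ in the noisy partial feedback setting. **Theorem (Noisy Partial Feedback is Always Beneficial).** For all $N,P_1,P_2>0$ and every $\sigma_2^2\ge 0$, $$\mathcal C_{\mathrm{MAC}}(P_1,P_2,N)\subset \mathcal C_{\mathrm{NoisyPartialFB}}(P_1,P_2,N,\sigma_2^2),$$ and the inclusion is strict. Moreover, $\mathcal C_{\mathrm{NoisyPartialFB}}(P_1,P_2,N,\sigma_2^2)$ contains a rate pair $(R_1,R_2)$ with $$R_1+R_2>\tfrac12\log\Bigl(1+\frac{P_1+P_2}{N}\Bigr).$$ -/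

import Mathlib

open MeasureTheory ProbabilityTheory Filter Topology
open scoped NNReal ENNReal

namespace GaussianMAC

/-- The law of `n` independent zero-mean Gaussian random variables of variance `v`
(a point mass at `0` when `v = 0`). -/
noncomputable def noiseLaw (n : ℕ) (v : ℝ≥0) : Measure (Fin n → ℝ) :=
  Measure.pi fun _ => gaussianReal 0 v

/-- The law of two independent messages, uniformly distributed over message sets of sizes
`k₁` and `k₂`. -/
noncomputable def messageLaw (k₁ k₂ : ℕ) : Measure (Fin k₁ × Fin k₂) :=
  (uniformOn (Set.univ : Set (Fin k₁))).prod (uniformOn (Set.univ : Set (Fin k₂)))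

/-- The expected average block-power constraint `(1/n) ∑ₜ E[Xₜ²] ≤ P`. The expectations are
taken in `[0, ∞]`, so inputs of infinite power are not admitted. -/
def PowerConstraint {Ω : Type*} [MeasurableSpace Ω] (μ : Measure Ω) {n : ℕ}
    (X : Fin n → Ω → ℝ) (P : ℝ≥0) : Prop :=
  (n : ℝ≥0∞)⁻¹ * ∑ t, ∫⁻ ω, ENNReal.ofReal (X t ω ^ 2) ∂μ ≤ P

/-! ### Noisy partial feedback -/

/-- Encoders and decoder of blocklength `n` for the two-user multiple-access channel with
feedback to Transmitter 2 only. The inputs of Transmitter 1 depend on its message only; the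
time-`t` input of Transmitter 2 depends on its message and on the feedback outputs at the times
before `t` (time is `0, …, n - 1`). -/
structure PartialFeedbackCode (n : ℕ) where
  /-- Size of the message set of Transmitter 1. -/
  size₁ : ℕ
  /-- Size of the message set of Transmitter 2. -/
  size₂ : ℕ
  size₁_pos : 0 < size₁
  size₂_pos : 0 < size₂
  enc₁ : (t : Fin n) → Fin size₁ → ℝ
  enc₂ : (t : Fin n) → Fin size₂ → (Fin t → ℝ) → ℝ
  measurable_enc₂ : ∀ t m, Measurable (enc₂ t m)
  dec : (Fin n → ℝ) → Fin size₁ × Fin size₂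
  measurable_dec : Measurable dec

namespace PartialFeedbackCode

variable {n : ℕ} (c : PartialFeedbackCode n)

/-- Outcomes `((m₁, m₂), (z, w))`: the two messages, the receiver noise, the feedback noise. -/
abbrev Outcome : Type :=
  (Fin c.size₁ × Fin c.size₂) × ((Fin n → ℝ) × (Fin n → ℝ))

/-- Messages, receiver noise (variance `N`) and feedback noise (variance `σsq`) are
independent. -/
noncomputable def law (N σsq : ℝ≥0) : Measure c.Outcome :=
  (messageLaw c.size₁ c.size₂).prod ((noiseLaw n N).prod (noiseLaw n σsq))

/-- The channel output `Yₜ = X₁,ₜ + X₂,ₜ + Zₜ`, where `X₂,ₜ` is computed from the message of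
Transmitter 2 and the feedback outputs `Vᵢ = Yᵢ + Wᵢ`, `i < t`. -/
noncomputable def output (ω : c.Outcome) (t : Fin n) : ℝ :=
  c.enc₁ t ω.1.1
    + c.enc₂ t ω.1.2 (fun i : Fin t =>
        output ω ⟨i.val, i.isLt.trans t.isLt⟩ + ω.2.2 ⟨i.val, i.isLt.trans t.isLt⟩)
    + ω.2.1 t
termination_by t.val
decreasing_by exact i.isLt

/-- The feedback output `Vₜ = Yₜ + Wₜ`. -/
noncomputable def feedback (ω : c.Outcome) (t : Fin n) : ℝ :=
  c.output ω t + ω.2.2 t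

/-- The channel input `X₁,ₜ`. -/
def input₁ (t : Fin n) (ω : c.Outcome) : ℝ :=
  c.enc₁ t ω.1.1

/-- The channel input `X₂,ₜ`. -/
noncomputable def input₂ (t : Fin n) (ω : c.Outcome) : ℝ :=
  c.enc₂ t ω.1.2 (fun i : Fin t => c.feedback ω ⟨i.val, i.isLt.trans t.isLt⟩)

theorem output_eq (ω : c.Outcome) (t : Fin n) :
    c.output ω t = c.input₁ t ω + c.input₂ t ω + ω.2.1 t := by
  rw [output]; rfl

/-- The code respects the powers `P₁`, `P₂` on the channel with noise variances `N`, `σsq`. -/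
def Admissible (P₁ P₂ N σsq : ℝ≥0) : Prop :=
  PowerConstraint (c.law N σsq) c.input₁ P₁ ∧ PowerConstraint (c.law N σsq) c.input₂ P₂

/-- The average probability of a decoding error. -/
noncomputable def errorProb (N σsq : ℝ≥0) : ℝ≥0∞ :=
  c.law N σsq {ω | c.dec (c.output ω) ≠ ω.1}

/-- The rate (in nats per channel use) of Transmitter 1. -/
noncomputable def rate₁ : ℝ := 1 / n * Real.log c.size₁

/-- The rate (in nats per channel use) of Transmitter 2. -/
noncomputable def rate₂ : ℝ := 1 / n * Real.log c.size₂

end PartialFeedbackCode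

/-- The capacity region of the multiple-access channel with noisy partial feedback to
Transmitter 2: the set of all achievable rate pairs. -/
def capacityPartialFB (P₁ P₂ N σsq : ℝ≥0) : Set (ℝ × ℝ) :=
  {R | 0 ≤ R.1 ∧ 0 ≤ R.2 ∧ ∀ δ : ℝ, 0 < δ → ∃ c : (n : ℕ) → PartialFeedbackCode n,
    (∀ᶠ n in atTop, (c n).Admissible P₁ P₂ N σsq ∧
      R.1 - δ < (c n).rate₁ ∧ R.2 - δ < (c n).rate₂) ∧
    Tendsto (fun n => (c n).errorProb N σsq) atTop (𝓝 0)}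

/-! ### No feedback -/

/-- Encoders and decoder of blocklength `n` for the two-user multiple-access channel without
feedback: the inputs of each transmitter depend on its message only. -/
structure NoFeedbackCode (n : ℕ) where
  /-- Size of the message set of Transmitter 1. -/
  size₁ : ℕ
  /-- Size of the message set of Transmitter 2. -/
  size₂ : ℕ
  size₁_pos : 0 < size₁
  size₂_pos : 0 < size₂
  enc₁ : (t : Fin n) → Fin size₁ → ℝ
  enc₂ : (t : Fin n) → Fin size₂ → ℝ
  dec : (Fin n → ℝ) → Fin size₁ × Fin size₂
  measurable_dec : Measurable dec

namespace NoFeedbackCode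

variable {n : ℕ} (c : NoFeedbackCode n)

/-- Outcomes `((m₁, m₂), z)`: the two messages and the receiver noise. -/
abbrev Outcome : Type := (Fin c.size₁ × Fin c.size₂) × (Fin n → ℝ)

/-- Messages and receiver noise (variance `N`) are independent. -/
noncomputable def law (N : ℝ≥0) : Measure c.Outcome :=
  (messageLaw c.size₁ c.size₂).prod (noiseLaw n N)

/-- The channel input `X₁,ₜ`. -/
def input₁ (t : Fin n) (ω : c.Outcome) : ℝ := c.enc₁ t ω.1.1

/-- The channel input `X₂,ₜ`. -/
def input₂ (t : Fin n) (ω : c.Outcome) : ℝ := c.enc₂ t ω.1.2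

/-- The channel output `Yₜ = X₁,ₜ + X₂,ₜ + Zₜ`. -/
noncomputable def output (ω : c.Outcome) (t : Fin n) : ℝ :=
  c.input₁ t ω + c.input₂ t ω + ω.2 t

/-- The code respects the powers `P₁`, `P₂` on the channel with noise variance `N`. -/
def Admissible (P₁ P₂ N : ℝ≥0) : Prop :=
  PowerConstraint (c.law N) c.input₁ P₁ ∧ PowerConstraint (c.law N) c.input₂ P₂

/-- The average probability of a decoding error. -/
noncomputable def errorProb (N : ℝ≥0) : ℝ≥0∞ :=
  c.law N {ω | c.dec (c.output ω) ≠ ω.1}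

/-- The rate (in nats per channel use) of Transmitter 1. -/
noncomputable def rate₁ : ℝ := 1 / n * Real.log c.size₁

/-- The rate (in nats per channel use) of Transmitter 2. -/
noncomputable def rate₂ : ℝ := 1 / n * Real.log c.size₂

end NoFeedbackCode

/-- The capacity region of the classical multiple-access channel without feedback: the set of
all achievable rate pairs. -/
def capacityMAC (P₁ P₂ N : ℝ≥0) : Set (ℝ × ℝ) :=
  {R | 0 ≤ R.1 ∧ 0 ≤ R.2 ∧ ∀ δ : ℝ, 0 < δ → ∃ c : (n : ℕ) → NoFeedbackCode n,
    (∀ᶠ n in atTop, (c n).Admissible P₁ P₂ N ∧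
      R.1 - δ < (c n).rate₁ ∧ R.2 - δ < (c n).rate₂) ∧
    Tendsto (fun n => (c n).errorProb N) atTop (𝓝 0)}

end GaussianMAC

/-! Feedback can be ignored, which gives the inclusion. Without feedback the sum rate is at most ½
log(1 + (P₁+P₂)/N) (`add_le_of_mem_capacityMAC`), so one feedback-achievable pair above this number
(`exists_mem_capacityPartialFB`) yields both strictness and the last claim.

Source of the gain. Channel uses are grouped in pairs. In the second use Transmitter 1 repeats its
first symbol a₁ with weight α, and Transmitter 2 adds κ(V - b₁) = κ(a₁ + z₁ + w₁). The two copies of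
a₁ add coherently, so the second output has power 2ακQ₁ beyond input powers plus noise. The weight β
of b₁ makes the two outputs uncorrelated, so this power is not wasted on redundancy. The price is an
effective noise N + κ²σ² instead of N in the second use. With α = ε and κ = cε both effects are of
order ε², but the gain is linear in c and the price quadratic, so a small c wins for every σ²
(`exists_linearScheme`).

Achievability is random coding with a threshold decoder over these blocks (`exists_codebook`,
`exists_block_codes`). A score is required only to have exponential mean at most 1 when the
competing symbols are independent of the output, and mean above the rate under the true law. Hence
it is never necessary to identify the scores with true conditional densities, and their means follow
from second moments alone. The deviation of the empirical energies is part of the averaged cost, so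
one codebook has both small error and the right power.

The converse is a change of measure to independent Gaussian outputs of variance P₁+P₂+N: the
exponential of (log-size if decoded correctly) plus (log-likelihood ratio) has mean at most 2, and
Jensen's inequality gives the Fano-type bound. -/

namespace GaussianMAC

/-! ### Gaussian densities and quadratic forms -/

/-- The logarithm of the density of the centred Gaussian law of variance `v`. -/
noncomputable def logDensity (v x : ℝ) : ℝ :=
  -(1 / 2) * Real.log (2 * Real.pi * v) - x ^ 2 / (2 * v)

theorem measurable_logDensity (v : ℝ) : Measurable (logDensity v) := by
  unfold logDensity; fun_prop

theorem exp_logDensity {v : ℝ≥0} (hv : 0 < v) (m x : ℝ) :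
    Real.exp (logDensity v (x - m)) = gaussianPDFReal m v x := by
  have hv' : (0 : ℝ) < v := hv
  have h : 0 < 2 * Real.pi * (v : ℝ) := by positivity
  rw [gaussianPDFReal, logDensity, sub_eq_add_neg, Real.exp_add, Real.sqrt_eq_rpow,
    Real.rpow_def_of_pos h, ← Real.exp_neg]
  congr 2
  · ring
  · ring

theorem lintegral_gaussianReal {v : ℝ≥0} (hv : 0 < v) (m : ℝ) {f : ℝ → ℝ≥0∞} (hf : Measurable f) :
    ∫⁻ x, f x ∂gaussianReal m v
      = ∫⁻ x, ENNReal.ofReal (Real.exp (logDensity v (x - m))) * f x := by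
  rw [gaussianReal_of_var_ne_zero _ hv.ne',
    lintegral_withDensity_eq_lintegral_mul _ (measurable_gaussianPDF m v) hf]
  simp only [Pi.mul_apply, gaussianPDF, exp_logDensity hv]

/-- Bayes' rule for a scalar Gaussian observation `y = c x + z`. -/
theorem logDensity_bayes {V P : ℝ} (hV : 0 < V) (hP : 0 < P) (c m x y : ℝ) :
    logDensity V (y - c * x) + logDensity P (x - m)
      = logDensity (V + c ^ 2 * P) (y - c * m)
        + logDensity (P * V / (V + c ^ 2 * P))
          (x - (m + c * P * (y - c * m) / (V + c ^ 2 * P))) := by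
  have hS : 0 < V + c ^ 2 * P := by positivity
  have hlog : Real.log (2 * Real.pi * V) + Real.log (2 * Real.pi * P)
      = Real.log (2 * Real.pi * (V + c ^ 2 * P))
        + Real.log (2 * Real.pi * (P * V / (V + c ^ 2 * P))) := by
    have hpi := Real.pi_pos
    rw [← Real.log_mul (by positivity) (by positivity),
      ← Real.log_mul (by positivity) (by positivity)]
    congr 1
    field_simp
  have hquad : (y - c * x) ^ 2 / (2 * V) + (x - m) ^ 2 / (2 * P)
      = (y - c * m) ^ 2 / (2 * (V + c ^ 2 * P))
        + (x - (m + c * P * (y - c * m) / (V + c ^ 2 * P))) ^ 2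
          / (2 * (P * V / (V + c ^ 2 * P))) := by
    field_simp
    ring
  unfold logDensity
  linarith

/-- Prior times likelihood is evidence times posterior. Keeping a test function `f` under the
posterior allows a second observation of the same symbol to be integrated out afterwards. -/
theorem lintegral_gaussianReal_bayes {V : ℝ} {P : ℝ≥0} (hV : 0 < V) (hP : 0 < P) (c m y : ℝ)
    {f : ℝ → ℝ≥0∞} (hf : Measurable f) :
    ∫⁻ x, ENNReal.ofReal (Real.exp (logDensity V (y - c * x))) * f x ∂gaussianReal m P
      = ENNReal.ofReal (Real.exp (logDensity (V + c ^ 2 * P) (y - c * m))) *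
        ∫⁻ x, f x ∂gaussianReal (m + c * P * (y - c * m) / (V + c ^ 2 * P))
          (P * V / (V + c ^ 2 * P)).toNNReal := by
  have hP' : (0 : ℝ) < P := hP
  have hpost : 0 < (P * V / (V + c ^ 2 * P)).toNNReal := Real.toNNReal_pos.2 (by positivity)
  have hm := measurable_logDensity
  rw [lintegral_gaussianReal hP m (by fun_prop), lintegral_gaussianReal hpost _ hf,
    ← lintegral_const_mul _ (by fun_prop)]
  refine lintegral_congr fun x => ?_
  rw [← mul_assoc, ← mul_assoc, ← ENNReal.ofReal_mul (Real.exp_nonneg _),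
    ← ENNReal.ofReal_mul (Real.exp_nonneg _), ← Real.exp_add, ← Real.exp_add,
    add_comm (logDensity P _), logDensity_bayes hV hP' c m x y,
    Real.coe_toNNReal _ (by positivity)]

theorem lintegral_gaussianReal_conv {V : ℝ} {P : ℝ≥0} (hV : 0 < V) (hP : 0 < P) (c m y K : ℝ) :
    ∫⁻ x, ENNReal.ofReal (Real.exp (K + logDensity V (y - c * x))) ∂gaussianReal m P
      = ENNReal.ofReal (Real.exp (K + logDensity (V + c ^ 2 * P) (y - c * m))) := by
  have h := lintegral_gaussianReal_bayes hV hP c m y (f := fun _ => ENNReal.ofReal (Real.exp K))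
    measurable_const
  simp only [lintegral_const, measure_univ, mul_one, ← ENNReal.ofReal_mul (Real.exp_nonneg _),
    ← Real.exp_add] at h
  simpa only [add_comm K] using h

/-- Integrating out the common Gaussian component of two observations. -/
theorem lintegral_gaussianReal_conv₂ {V W : ℝ} {P : ℝ≥0} (hV : 0 < V) (hW : 0 < W) (hP : 0 < P)
    (c d y z K : ℝ) :
    ∫⁻ x, ENNReal.ofReal (Real.exp (K + logDensity V (y - c * x) + logDensity W (z - d * x)))
        ∂gaussianReal 0 P
      = ENNReal.ofReal (Real.exp (K + logDensity (V + c ^ 2 * P) y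
        + logDensity (W + d ^ 2 * (P * V / (V + c ^ 2 * P)))
            (z - d * (c * P * y / (V + c ^ 2 * P))))) := by
  have hP' : (0 : ℝ) < P := hP
  have hpost : 0 < (P * V / (V + c ^ 2 * P)).toNNReal := Real.toNNReal_pos.2 (by positivity)
  have hm := measurable_logDensity
  have h := lintegral_gaussianReal_bayes hV hP c 0 y
    (f := fun x => ENNReal.ofReal (Real.exp (K + logDensity W (z - d * x)))) (by fun_prop)
  rw [lintegral_gaussianReal_conv hW hpost] at h
  simp only [← ENNReal.ofReal_mul (Real.exp_nonneg _), ← Real.exp_add, mul_zero, sub_zero,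
    zero_add] at h
  rw [Real.coe_toNNReal _ (by positivity)] at h
  simp only [add_assoc, add_left_comm K]
  exact h

/-! ### Second moments of centred variables -/

/-- A square-integrable centred random variable `f` of variance `v`. -/
structure Centered {X : Type*} [MeasurableSpace X] (ρ : Measure X) (f : X → ℝ) (v : ℝ) :
    Prop where
  memLp : MemLp f 2 ρ
  mean : ∫ x, f x ∂ρ = 0
  second : ∫ x, f x ^ 2 ∂ρ = v

namespace Centered

variable {X X' : Type*} [MeasurableSpace X] [MeasurableSpace X'] {ρ : Measure X} {ρ' : Measure X'}
  {f : X → ℝ} {g : X' → ℝ} {v w : ℝ}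

theorem integrable_sq (h : Centered ρ f v) : Integrable (fun x => f x ^ 2) ρ :=
  h.memLp.integrable_sq

theorem integrable [IsFiniteMeasure ρ] (h : Centered ρ f v) : Integrable f ρ :=
  h.memLp.integrable (by norm_num)

theorem gaussianReal (v : ℝ≥0) : Centered (gaussianReal 0 v) (fun x => x) v where
  memLp := memLp_id_gaussianReal 2
  mean := integral_id_gaussianReal
  second := by
    have h := variance_fun_id_gaussianReal (μ := 0) (v := v)
    rwa [variance_of_integral_eq_zero (by fun_prop) integral_id_gaussianReal] at h

theorem const_mul (h : Centered ρ f v) (c : ℝ) : Centered ρ (fun x => c * f x) (c ^ 2 * v) where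
  memLp := h.memLp.const_mul c
  mean := by rw [integral_const_mul, h.mean, mul_zero]
  second := by simp only [mul_pow]; rw [integral_const_mul, h.second]

theorem prod [IsProbabilityMeasure ρ] [IsProbabilityMeasure ρ'] (hf : Centered ρ f v)
    (hg : Centered ρ' g w) : Centered (ρ.prod ρ') (fun p => f p.1 + g p.2) (v + w) where
  memLp := (hf.memLp.comp_fst ρ').add (hg.memLp.comp_snd ρ)
  mean := by
    rw [integral_add ((hf.integrable).comp_fst ρ') ((hg.integrable).comp_snd ρ),
      integral_fun_fst, integral_fun_snd, hf.mean, hg.mean]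
    simp
  second := by
    have e : ∀ p : X × X', (f p.1 + g p.2) ^ 2
        = f p.1 ^ 2 + g p.2 ^ 2 + 2 * (f p.1 * g p.2) := fun p => by ring
    have i1 : Integrable (fun p : X × X' => f p.1 ^ 2) (ρ.prod ρ') :=
      hf.integrable_sq.comp_fst ρ'
    have i2 : Integrable (fun p : X × X' => g p.2 ^ 2) (ρ.prod ρ') :=
      hg.integrable_sq.comp_snd ρ
    have i3 : Integrable (fun p : X × X' => 2 * (f p.1 * g p.2)) (ρ.prod ρ') :=
      (hf.integrable.mul_prod hg.integrable).const_mul 2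
    simp only [e]
    rw [integral_add (f := fun p : X × X' => f p.1 ^ 2 + g p.2 ^ 2) (i1.add i2) i3,
      integral_add i1 i2, integral_fun_fst (fun x => f x ^ 2),
      integral_fun_snd (fun x => g x ^ 2), integral_const_mul, integral_prod_mul, hf.mean,
      hf.second, hg.second]
    simp

theorem integrable_logDensity [IsFiniteMeasure ρ] (h : Centered ρ f v) (V : ℝ) :
    Integrable (fun x => logDensity V (f x)) ρ :=
  (integrable_const _).sub (h.integrable_sq.div_const _)

/-- `logDensity` is quadratic, so its mean depends on `f` only through the second moment; `f` need
not be Gaussian. -/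
theorem integral_logDensity [IsProbabilityMeasure ρ] (h : Centered ρ f v) (V : ℝ) :
    ∫ x, logDensity V (f x) ∂ρ = -(1 / 2) * Real.log (2 * Real.pi * V) - v / (2 * V) := by
  unfold logDensity
  rw [integral_sub (integrable_const _) (h.integrable_sq.div_const _), integral_div, h.second]
  simp

end Centered

/-! ### Products of probability measures -/

section Products

variable {X : Type*} [MeasurableSpace X] {ι : Type*} [Fintype ι]

theorem map_pi_precomp {κ : Type*} [Fintype κ] (ρ : Measure X) [IsProbabilityMeasure ρ]
    {s : ι → κ} (hs : Function.Injective s) :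
    (Measure.pi fun _ : κ => ρ).map (fun x i => x (s i)) = Measure.pi fun _ : ι => ρ := by
  have h := Measure.map_infinitePi_infinitePi_of_inj (P := fun _ : κ => ρ) hs
  simpa only [Measure.infinitePi_eq_pi] using h

theorem lintegral_pi_prod_eq (ρ : ι → Measure X) [∀ i, IsProbabilityMeasure (ρ i)]
    {f : ι → X → ℝ≥0∞} (hf : ∀ i, Measurable (f i)) :
    ∫⁻ x, ∏ i, f i (x i) ∂Measure.pi ρ = ∏ i, ∫⁻ x, f i x ∂ρ i := by
  have h := lintegral_prod_eq_prod_lintegral_of_indepFun Finset.univ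
    (fun i (x : ι → X) => f i (x i)) (iIndepFun_pi (μ := ρ) fun i => (hf i).aemeasurable)
    (fun i => (hf i).comp (measurable_pi_apply i))
  rw [h]
  refine Finset.prod_congr rfl fun i _ => ?_
  rw [← (measurePreserving_eval ρ i).map_eq, lintegral_map (hf i) (measurable_pi_apply i)]

/-- The weak law of large numbers, in mean. -/
theorem tendsto_lintegral_average_sub (ρ : Measure X) [IsProbabilityMeasure ρ] {g : X → ℝ}
    (hg : Measurable g) (hi : Integrable g ρ) :
    Tendsto (fun k : ℕ => ∫⁻ x, ‖(k : ℝ)⁻¹ * ∑ t, g (x t) - ∫ y, g y ∂ρ‖ₑ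
      ∂(Measure.pi fun _ : Fin k => ρ)) atTop (𝓝 0) := by
  -- All sample sizes are realised on one infinite product, where the L¹ law of large numbers
  -- applies; the mean for each `k` involves only the first `k` coordinates.
  set Q := Measure.infinitePi fun _ : ℕ => ρ
  have hmp : ∀ i : ℕ, MeasurePreserving (Function.eval i) Q ρ := fun i =>
    measurePreserving_eval_infinitePi _ i
  have h0 : ∫ x, g (x 0) ∂Q = ∫ y, g y ∂ρ := by
    rw [← (hmp 0).map_eq, integral_map (hmp 0).aemeasurable hg.aestronglyMeasurable]
  have h := strong_law_Lp (μ := Q) (p := 1) le_rfl (by simp) (fun i (x : ℕ → X) => g (x i))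
    (memLp_one_iff_integrable.2 ((hmp 0).integrable_comp_of_integrable hi))
    (fun i j hij => (iIndepFun_infinitePi (P := fun _ : ℕ => ρ) (X := fun _ => g)
      fun _ => hg).indepFun hij)
    (fun i => by
      refine ⟨(hg.comp (hmp i).measurable).aemeasurable,
        (hg.comp (hmp 0).measurable).aemeasurable, ?_⟩
      change Q.map (g ∘ Function.eval i) = Q.map (g ∘ Function.eval 0)
      rw [← Measure.map_map hg (hmp i).measurable, ← Measure.map_map hg (hmp 0).measurable,
        (hmp i).map_eq, (hmp 0).map_eq])
  refine h.congr fun k => ?_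
  rw [eLpNorm_one_eq_lintegral_enorm, h0]
  have hk := Measure.map_infinitePi_infinitePi_of_inj (P := fun _ : ℕ => ρ)
    (Fin.val_injective (n := k))
  rw [Measure.infinitePi_eq_pi (ι := Fin k)] at hk
  rw [← hk, lintegral_map (by fun_prop) (by fun_prop)]
  refine lintegral_congr fun x => ?_
  rw [Finset.sum_range (fun i => g (x i)), smul_eq_mul]

end Products

/-! ### Random coding for two transmitters -/

theorem isProbabilityMeasure_messageLaw {k₁ k₂ : ℕ} (h₁ : 0 < k₁) (h₂ : 0 < k₂) :
    IsProbabilityMeasure (messageLaw k₁ k₂) := by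
  have := Fin.pos_iff_nonempty.1 h₁
  have := Fin.pos_iff_nonempty.1 h₂
  unfold messageLaw
  infer_instance

section Slices

variable {X X' : Type*} [MeasurableSpace X] [MeasurableSpace X'] {S : Set (X × X')} {t : ℝ≥0∞}

theorem prod_le_of_forall_slice_left (μ : Measure X) [SFinite μ] (ν : Measure X')
    [IsProbabilityMeasure ν] (hS : MeasurableSet S) (h : ∀ y, μ {x | (x, y) ∈ S} ≤ t) :
    (μ.prod ν) S ≤ t := by
  rw [Measure.prod_apply_symm hS]
  exact (lintegral_mono h).trans (by simp)

theorem prod_le_of_forall_slice_right (μ : Measure X) [IsProbabilityMeasure μ] (ν : Measure X')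
    [SFinite ν] (hS : MeasurableSet S) (h : ∀ x, ν {y | (x, y) ∈ S} ≤ t) :
    (μ.prod ν) S ≤ t := by
  rw [Measure.prod_apply hS]
  exact (lintegral_mono h).trans (by simp)

theorem map_pi_pair {ι : Type*} [Fintype ι] (μ : Measure X) [IsProbabilityMeasure μ] {i j : ι}
    (hij : i ≠ j) : (Measure.pi fun _ : ι => μ).map (fun x => (x i, x j)) = μ.prod μ := by
  have h := Measure.infinitePi_map_eval_prod (P := fun _ : ι => μ) hij
  rwa [Measure.infinitePi_eq_pi] at h

theorem pi_pair_le {ι : Type*} [Fintype ι] (μ : Measure X) [IsProbabilityMeasure μ] {i j : ι}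
    (hij : i ≠ j) {S : Set (X × X)} (hS : MeasurableSet S) (h : ∀ y, μ {x | (x, y) ∈ S} ≤ t) :
    (Measure.pi fun _ : ι => μ) {x | (x i, x j) ∈ S} ≤ t := by
  have hm := Measure.map_apply (μ := Measure.pi fun _ : ι => μ)
    (f := fun x => (x i, x j)) (by fun_prop) hS
  rw [map_pi_pair μ hij] at hm
  exact hm.symm.le.trans (prod_le_of_forall_slice_left μ μ hS h)

end Slices

/-- Sent and competing codewords of both transmitters are four independent variables, so it suffices
to bound the competing pair with the sent pair `(x', y')` frozen. -/
theorem pi_pair_pair_le {A B : Type*} [MeasurableSpace A] [MeasurableSpace B] (μ : Measure A)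
    [IsProbabilityMeasure μ] (ν : Measure B) [IsProbabilityMeasure ν] {ι κ : Type*} [Fintype ι]
    [Fintype κ] {i i' : ι} {j j' : κ} (hi : i ≠ i') (hj : j ≠ j') {t : ℝ≥0∞}
    {S : Set ((A × A) × (B × B))} (hS : MeasurableSet S)
    (h : ∀ x' y', (μ.prod ν) {q | ((q.1, x'), (q.2, y')) ∈ S} ≤ t) :
    ((Measure.pi fun _ : ι => μ).prod (Measure.pi fun _ : κ => ν))
      {c | ((c.1 i, c.1 i'), (c.2 j, c.2 j')) ∈ S} ≤ t := by
  have hmap : ((Measure.pi fun _ : ι => μ).prod (Measure.pi fun _ : κ => ν)).map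
      (Prod.map (fun x : ι → A => (x i, x i')) (fun y : κ → B => (y j, y j')))
      = (μ.prod μ).prod (ν.prod ν) := by
    rw [← Measure.map_prod_map _ _ (by fun_prop) (by fun_prop), map_pi_pair μ hi,
      map_pi_pair ν hj]
  have hm := Measure.map_apply (μ := (Measure.pi fun _ : ι => μ).prod (Measure.pi fun _ : κ => ν))
    (f := Prod.map (fun x : ι → A => (x i, x i')) (fun y : κ → B => (y j, y j')))
    (by fun_prop) hS
  rw [hmap] at hm
  refine hm.symm.le.trans ?_
  rw [Measure.prod_apply hS, lintegral_prod_symm _ (measurable_measure_prodMk_left hS).aemeasurable]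
  refine (lintegral_mono (g := fun _ => t) fun x' => ?_).trans (by simp)
  have hS1 : ∀ x, MeasurableSet (Prod.mk (x, x') ⁻¹' S) := fun x => measurable_prodMk_left hS
  simp only [Measure.prod_apply_symm (hS1 _)]
  have hS2 : MeasurableSet {q : (A × B) × B | ((q.1.1, x'), (q.2, q.1.2)) ∈ S} :=
    (show Measurable fun q : (A × B) × B => ((q.1.1, x'), (q.2, q.1.2)) by fun_prop) hS
  rw [lintegral_lintegral_swap (measurable_measure_prodMk_left hS2).aemeasurable]
  refine (lintegral_mono (g := fun _ => t) fun y' => ?_).trans (by simp)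
  have hS3 : MeasurableSet {q : A × B | ((q.1, x'), (q.2, y')) ∈ S} :=
    (show Measurable fun q : A × B => ((q.1, x'), (q.2, y')) by fun_prop) hS
  have := h x' y'
  rw [Measure.prod_apply hS3] at this
  exact this

/-- The choice at `y` depends only on the finite pattern of sets `D i` containing `y`, so any choice
function on patterns is measurable. When several sets contain `y`, or none does, its value is
immaterial. -/
theorem exists_measurable_selection {ι Y : Type*} [Finite ι] [Nonempty ι] [MeasurableSpace ι]
    [MeasurableSpace Y] (D : ι → Set Y) (hD : ∀ i, MeasurableSet (D i)) :
    ∃ dec : Y → ι, Measurable dec ∧ ∀ y i, y ∈ D i → (∀ j, y ∈ D j → j = i) → dec y = i := by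
  classical
  let φ : Y → ι → Prop := fun y i => y ∈ D i
  let ψ : (ι → Prop) → ι := fun s => if h : ∃ i, s i then h.choose else Classical.arbitrary ι
  have hφ : Measurable φ := measurable_pi_lambda _ fun i => measurableSet_setOfPred.1 (hD i)
  refine ⟨ψ ∘ φ, (measurable_of_finite ψ).comp hφ, fun y i hi hu => ?_⟩
  have hex : ∃ i, φ y i := ⟨i, hi⟩
  have : ψ (φ y) = hex.choose := dif_pos hex
  exact this.trans (hu _ hex.choose_spec)

theorem measurable_prod_of_countable_middle {C M E F : Type*} [MeasurableSpace C]
    [MeasurableSpace M] [MeasurableSpace E] [MeasurableSpace F] [Countable M]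
    [MeasurableSingletonClass M] {f : C → M → E → F}
    (h : ∀ m, Measurable fun q : C × E => f q.1 m q.2) :
    Measurable fun q : C × (M × E) => f q.1 q.2.1 q.2.2 := by
  have h' : Measurable fun q : M × (C × E) => f q.2.1 q.1 q.2.2 :=
    measurable_from_prod_countable_right h
  exact h'.comp (f := fun q : C × (M × E) => (q.2.1, (q.1, q.2.2))) (by fun_prop)

section OneShot

variable {A B E Y : Type*} [MeasurableSpace A] [MeasurableSpace B] [MeasurableSpace E]
  [MeasurableSpace Y]

/-- Codebooks of sizes `M₁`, `M₂` for two transmitters with codewords in `A`, `B`. -/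
abbrev CodebookPair (M₁ M₂ : ℕ) (A B : Type*) : Type _ := (Fin M₁ → A) × (Fin M₂ → B)

open Classical in
/-- Random coding with a threshold decoder: there are codebooks for which the error probability
plus the expected cost `p` is bounded by its single-letter value plus the union bound. -/
theorem exists_codebook (μ : Measure A) [IsProbabilityMeasure μ] (ν : Measure B)
    [IsProbabilityMeasure ν] (η : Measure E) [IsProbabilityMeasure η] {f : A → B → E → Y}
    (hf : Measurable fun q : A × (B × E) => f q.1 q.2.1 q.2.2) {T : Set (A × (B × Y))}
    (hT : MeasurableSet T) {p : A × (B × E) → ℝ≥0∞} (hp : Measurable p) {M₁ M₂ : ℕ}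
    (hM₁ : 0 < M₁) (hM₂ : 0 < M₂) {t₁ t₂ t : ℝ≥0∞} (h₁ : ∀ b y, μ {a | (a, b, y) ∈ T} ≤ t₁)
    (h₂ : ∀ a y, ν {b | (a, b, y) ∈ T} ≤ t₂)
    (h : ∀ y, (μ.prod ν) {q | (q.1, q.2, y) ∈ T} ≤ t) :
    ∃ (a : Fin M₁ → A) (b : Fin M₂ → B) (dec : Y → Fin M₁ × Fin M₂), Measurable dec ∧
      ∫⁻ ω, ((if dec (f (a ω.1.1) (b ω.1.2) ω.2) ≠ ω.1 then 1 else 0)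
          + p (a ω.1.1, b ω.1.2, ω.2)) ∂((messageLaw M₁ M₂).prod η)
        ≤ ∫⁻ q, ((if (q.1, q.2.1, f q.1 q.2.1 q.2.2) ∉ T then 1 else 0) + p q)
            ∂(μ.prod (ν.prod η)) + M₁ * t₁ + M₂ * t₂ + M₁ * M₂ * t := by
  have := Fin.pos_iff_nonempty.1 hM₁
  have := Fin.pos_iff_nonempty.1 hM₂
  have := isProbabilityMeasure_messageLaw hM₁ hM₂
  set base : A × (B × E) → ℝ≥0∞ :=
    fun q => (if (q.1, q.2.1, f q.1 q.2.1 q.2.2) ∉ T then 1 else 0) + p q with hbase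
  have hTm : Measurable fun q : A × (B × Y) => q ∈ T := measurableSet_setOfPred.1 hT
  have hbase_m : Measurable base := by
    refine Measurable.add (Measurable.ite ?_ measurable_const measurable_const) hp
    exact ((show Measurable fun q : A × (B × E) => (q.1, q.2.1, f q.1 q.2.1 q.2.2) from
      measurable_fst.prodMk (measurable_snd.fst.prodMk hf)) hT).compl
  let cl : Measure (CodebookPair M₁ M₂ A B) := (Measure.pi fun _ => μ).prod (Measure.pi fun _ => ν)
  let hit : (Fin M₁ × Fin M₂) → (Fin M₁ × Fin M₂) →
      Set (CodebookPair M₁ M₂ A B × E) := fun m m' =>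
    {q | (q.1.1 m'.1, q.1.2 m'.2, f (q.1.1 m.1) (q.1.2 m.2) q.2) ∈ T}
  have hout : ∀ m : Fin M₁ × Fin M₂,
      Measurable fun q : CodebookPair M₁ M₂ A B × E => f (q.1.1 m.1) (q.1.2 m.2) q.2 := fun m =>
    hf.comp (f := fun q : CodebookPair M₁ M₂ A B × E => (q.1.1 m.1, q.1.2 m.2, q.2)) (by fun_prop)
  have hhit : ∀ m m', MeasurableSet (hit m m') := fun m m' =>
    (show Measurable fun q : CodebookPair M₁ M₂ A B × E =>
        (q.1.1 m'.1, q.1.2 m'.2, f (q.1.1 m.1) (q.1.2 m.2) q.2) from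
      Measurable.prodMk (by fun_prop) (Measurable.prodMk (by fun_prop) (hout m))) hT
  -- The failure of the sent pair to pass the threshold, the penalty `p`, and the number of wrong
  -- pairs that pass. Wrong pairs are sorted by which messages differ, because a pair sharing one
  -- message also shares a codeword with the output.
  let cost : CodebookPair M₁ M₂ A B → (Fin M₁ × Fin M₂) → E → ℝ≥0∞ := fun c m e =>
    base (c.1 m.1, c.2 m.2, e)
      + ∑ i ∈ Finset.univ.erase m.1, (hit m (i, m.2)).indicator 1 (c, e)
      + ∑ j ∈ Finset.univ.erase m.2, (hit m (m.1, j)).indicator 1 (c, e)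
      + ∑ i ∈ Finset.univ.erase m.1, ∑ j ∈ Finset.univ.erase m.2,
          (hit m (i, j)).indicator 1 (c, e)
  have hind : ∀ m m', Measurable fun q : CodebookPair M₁ M₂ A B × E =>
      (hit m m').indicator (1 : CodebookPair M₁ M₂ A B × E → ℝ≥0∞) (q.1, q.2) :=
    fun m m' => measurable_one.indicator (hhit m m')
  have hb1 : ∀ m : Fin M₁ × Fin M₂, Measurable fun q : CodebookPair M₁ M₂ A B × E =>
      base (q.1.1 m.1, q.1.2 m.2, q.2) :=
    fun m => hbase_m.comp
      (f := fun q : CodebookPair M₁ M₂ A B × E => (q.1.1 m.1, q.1.2 m.2, q.2)) (by fun_prop)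
  have hcost : ∀ m, Measurable fun q : CodebookPair M₁ M₂ A B × E => cost q.1 m q.2 := fun m =>
    (((hb1 m).add (Finset.measurable_fun_sum _ fun i _ => hind m (i, m.2))).add
      (Finset.measurable_fun_sum _ fun j _ => hind m (m.1, j))).add
      (Finset.measurable_fun_sum _ fun i _ => Finset.measurable_fun_sum _ fun j _ => hind m (i, j))
  have hcost' := measurable_prod_of_countable_middle hcost
  set θ := ∫⁻ q, base q ∂(μ.prod (ν.prod η)) + M₁ * t₁ + M₂ * t₂ + M₁ * M₂ * t with hθ
  have hI : ∀ m m', ∫⁻ q,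
      (hit m m').indicator (1 : CodebookPair M₁ M₂ A B × E → ℝ≥0∞) (q.1, q.2) ∂(cl.prod η)
      = (cl.prod η) (hit m m') := fun m m' => lintegral_indicator_one (hhit m m')
  have hcard₁ : ∀ i : Fin M₁, (Finset.univ.erase i).card ≤ M₁ := fun i => 
    Finset.card_erase_le.trans (by simp)
  have hcard₂ : ∀ i : Fin M₂, (Finset.univ.erase i).card ≤ M₂ := fun i => 
    Finset.card_erase_le.trans (by simp)
  have hmean : ∀ m, ∫⁻ q, cost q.1 m q.2 ∂(cl.prod η) ≤ θ := by
    intro m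
    have hmp : MeasurePreserving
        (fun q : CodebookPair M₁ M₂ A B × E => (q.1.1 m.1, q.1.2 m.2, q.2)) (cl.prod η)
        (μ.prod (ν.prod η)) :=
      (measurePreserving_prodAssoc μ ν η).comp
        (((measurePreserving_eval (fun _ => μ) m.1).prod
          (measurePreserving_eval (fun _ => ν) m.2)).prod (MeasurePreserving.id η))
    -- Freezing the noise, the second codebook and the sent first codeword fixes the output; the
    -- wrong codeword `i` is still distributed as `μ`.
    have hit₁ : ∀ i, i ≠ m.1 → (cl.prod η) (hit m (i, m.2)) ≤ t₁ := fun i hi => by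
      refine prod_le_of_forall_slice_left _ _ (hhit _ _) fun e => ?_
      have hs : MeasurableSet {c : CodebookPair M₁ M₂ A B | (c, e) ∈ hit m (i, m.2)} :=
        (measurable_prodMk_right (y := e)) (hhit m (i, m.2))
      refine prod_le_of_forall_slice_left _ _ hs fun b => ?_
      refine pi_pair_le μ hi (S := {x | (x.1, b m.2, f x.2 (b m.2) e) ∈ T}) ?_
        fun a' => h₁ (b m.2) (f a' (b m.2) e)
      exact (show Measurable fun x : A × A => (x.1, b m.2, f x.2 (b m.2) e) from
        measurable_fst.prodMk (measurable_const.prodMk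
          (hf.comp (f := fun x : A × A => (x.2, b m.2, e)) (by fun_prop)))) hT
    have hit₂ : ∀ j, j ≠ m.2 → (cl.prod η) (hit m (m.1, j)) ≤ t₂ := fun j hj => by
      refine prod_le_of_forall_slice_left _ _ (hhit _ _) fun e => ?_
      have hs : MeasurableSet {c : CodebookPair M₁ M₂ A B | (c, e) ∈ hit m (m.1, j)} :=
        (measurable_prodMk_right (y := e)) (hhit m (m.1, j))
      refine prod_le_of_forall_slice_right _ _ hs fun a => ?_
      refine pi_pair_le ν hj (S := {x | (a m.1, x.1, f (a m.1) x.2 e) ∈ T}) ?_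
        fun a' => h₂ (a m.1) (f (a m.1) a' e)
      exact (show Measurable fun x : B × B => (a m.1, x.1, f (a m.1) x.2 e) from
        measurable_const.prodMk (measurable_fst.prodMk
          (hf.comp (f := fun x : B × B => (a m.1, x.2, e)) (by fun_prop)))) hT
    have hit₃ : ∀ i j, i ≠ m.1 → j ≠ m.2 → (cl.prod η) (hit m (i, j)) ≤ t := fun i j hi hj => by
      refine prod_le_of_forall_slice_left _ _ (hhit _ _) fun e => ?_
      refine pi_pair_pair_le μ ν hi hj
        (S := {x | (x.1.1, x.2.1, f x.1.2 x.2.2 e) ∈ T}) ?_ fun x' y' => h (f x' y' e)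
      exact (show Measurable fun x : (A × A) × (B × B) => (x.1.1, x.2.1, f x.1.2 x.2.2 e) from
        Measurable.prodMk (by fun_prop) (Measurable.prodMk (by fun_prop)
          (hf.comp (f := fun x : (A × A) × (B × B) => (x.1.2, x.2.2, e)) (by fun_prop)))) hT
    simp only [cost]
    rw [lintegral_add_right _ (Finset.measurable_fun_sum _ fun i _ =>
        Finset.measurable_fun_sum _ fun j _ => hind m (i, j)),
      lintegral_add_right _ (Finset.measurable_fun_sum _ fun j _ => hind m (m.1, j)),
      lintegral_add_right _ (Finset.measurable_fun_sum _ fun i _ => hind m (i, m.2)),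
      lintegral_finsetSum _ fun i _ => hind m (i, m.2),
      lintegral_finsetSum _ fun j _ => hind m (m.1, j),
      lintegral_finsetSum _ fun i _ => Finset.measurable_fun_sum _ fun j _ => hind m (i, j)]
    simp only [lintegral_finsetSum _ fun j _ => hind m (_, j), hI]
    rw [hθ, ← hmp.lintegral_comp hbase_m]
    gcongr
    · refine (Finset.sum_le_card_nsmul _ _ t₁ fun i hi =>
        hit₁ i (Finset.ne_of_mem_erase hi)).trans ?_
      rw [nsmul_eq_mul]
      gcongr
      exact hcard₁ _
    · refine (Finset.sum_le_card_nsmul _ _ t₂ fun j hj =>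
        hit₂ j (Finset.ne_of_mem_erase hj)).trans ?_
      rw [nsmul_eq_mul]
      gcongr
      exact hcard₂ _
    · refine (Finset.sum_le_card_nsmul _ _ (M₂ * t) fun i hi =>
        (Finset.sum_le_card_nsmul _ _ t fun j hj => hit₃ i j (Finset.ne_of_mem_erase hi)
          (Finset.ne_of_mem_erase hj)).trans ?_).trans ?_
      · rw [nsmul_eq_mul]
        gcongr
        exact hcard₂ _
      · rw [nsmul_eq_mul, mul_assoc]
        gcongr
        exact hcard₁ _
  -- Some codebook costs at most the average over codebooks; exchanging the integrals reduces that
  -- average to the bound per message pair.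
  obtain ⟨c, hc⟩ := exists_le_lintegral (μ := cl)
    (f := fun c => ∫⁻ ω, cost c ω.1 ω.2 ∂((messageLaw M₁ M₂).prod η))
    (hcost'.lintegral_prod_right' (ν := (messageLaw M₁ M₂).prod η)).aemeasurable
  have hcθ : ∫⁻ ω, cost c ω.1 ω.2 ∂((messageLaw M₁ M₂).prod η) ≤ θ := by
    refine hc.trans ?_
    rw [lintegral_lintegral_swap hcost'.aemeasurable]
    rw [lintegral_prod]
    · refine (lintegral_mono (g := fun _ => θ) fun m => ?_).trans (by simp)
      refine le_trans (le_of_eq ?_) (hmean m)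
      rw [lintegral_prod_symm _ (hcost m).aemeasurable]
    · exact (hcost'.lintegral_prod_left' (μ := cl)).aemeasurable
  obtain ⟨dec, hdec, hsel⟩ := exists_measurable_selection
    (fun m : Fin M₁ × Fin M₂ => {y : Y | (c.1 m.1, c.2 m.2, y) ∈ T})
    (fun m => (show Measurable fun y : Y => (c.1 m.1, c.2 m.2, y) by fun_prop) hT)
  refine ⟨c.1, c.2, dec, hdec, le_trans (lintegral_mono fun ω => ?_) hcθ⟩
  obtain ⟨m, e⟩ := ω
  simp only [cost, hbase]
  by_cases hd : dec (f (c.1 m.1) (c.2 m.2) e) = m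
  · rw [if_neg (not_not.2 hd), zero_add]
    exact le_add_right (le_add_right (le_add_right (le_add_left le_rfl)))
  rw [if_pos hd]
  -- If decoding fails although the sent pair passes, another pair must pass too, and its indicator
  -- in one of the three sums pays for the error.
  by_cases hT' : (c.1 m.1, c.2 m.2, f (c.1 m.1) (c.2 m.2) e) ∈ T
  · rw [if_neg (not_not.2 hT'), zero_add]
    have : ∃ m', (c.1 m'.1, c.2 m'.2, f (c.1 m.1) (c.2 m.2) e) ∈ T ∧ m' ≠ m := by
      by_contra! hall
      exact hd (hsel _ m hT' fun j hj => hall j hj)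
    obtain ⟨⟨i, j⟩, hm', hne⟩ := this
    have hone : (hit m (i, j)).indicator (1 : CodebookPair M₁ M₂ A B × E → ℝ≥0∞) (c, e) = 1 :=
      Set.indicator_of_mem (show (c, e) ∈ hit m (i, j) from hm') _
    have hle : ∀ {ι : Type} [DecidableEq ι] {s : Finset ι} {x : ι} (g : ι → ℝ≥0∞), x ∈ s →
        g x ≤ ∑ y ∈ s, g y :=
      fun g hx => Finset.single_le_sum (f := g) (fun _ _ => zero_le) hx
    by_cases hi : i = m.1
    · have hj : j ≠ m.2 := fun hj => hne (Prod.ext hi hj)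
      have := hle (fun j => (hit m (m.1, j)).indicator (1 : CodebookPair M₁ M₂ A B × E → ℝ≥0∞) (c, e))
        (Finset.mem_erase.2 ⟨hj, Finset.mem_univ j⟩)
      rw [hi] at hone
      simp only [hone] at this
      rw [add_comm]
      refine le_add_right ?_
      rw [add_assoc]
      exact add_le_add le_rfl (this.trans (le_add_left le_rfl))
    · by_cases hj : j = m.2
      · have := hle (fun i => (hit m (i, m.2)).indicator (1 : CodebookPair M₁ M₂ A B × E → ℝ≥0∞) (c, e))
          (Finset.mem_erase.2 ⟨hi, Finset.mem_univ i⟩)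
        rw [hj] at hone
        simp only [hone] at this
        rw [add_comm]
        refine le_add_right (le_add_right ?_)
        exact add_le_add le_rfl this
      · have h2 := hle (fun i => ∑ j ∈ Finset.univ.erase m.2,
          (hit m (i, j)).indicator (1 : CodebookPair M₁ M₂ A B × E → ℝ≥0∞) (c, e))
          (Finset.mem_erase.2 ⟨hi, Finset.mem_univ i⟩)
        have h3 := hle (fun j => (hit m (i, j)).indicator (1 : CodebookPair M₁ M₂ A B × E → ℝ≥0∞) (c, e))
          (Finset.mem_erase.2 ⟨hj, Finset.mem_univ j⟩)
        simp only [hone] at h3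
        rw [add_comm, add_assoc, add_assoc]
        exact add_le_add le_rfl (le_add_left (le_add_left (h3.trans h2)))
  · rw [if_pos hT']
    exact le_add_right (le_add_right (le_add_right le_rfl))

end OneShot

/-! ### Block coding over a memoryless two-transmitter channel -/

/-- Markov's inequality for the exponential of the sum, whose mean factorises over the coordinates.
-/
theorem pi_chernoff {X : Type*} [MeasurableSpace X] (ρ : Measure X) [IsProbabilityMeasure ρ]
    {k : ℕ} {h : Fin k → X → ℝ} (hm : ∀ t, Measurable (h t))
    (h1 : ∀ t, ∫⁻ x, ENNReal.ofReal (Real.exp (h t x)) ∂ρ ≤ 1) (τ : ℝ) :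
    (Measure.pi fun _ : Fin k => ρ) {x | τ ≤ ∑ t, h t (x t)}
      ≤ ENNReal.ofReal (Real.exp (-τ)) := by
  have hpos : ENNReal.ofReal (Real.exp τ) ≠ 0 := by simp [Real.exp_pos]
  have hle : ∫⁻ x, ∏ t, ENNReal.ofReal (Real.exp (h t (x t))) ∂(Measure.pi fun _ : Fin k => ρ)
      ≤ 1 := by
    rw [lintegral_pi_prod_eq (fun _ => ρ) fun t => (hm t).exp.ennreal_ofReal]
    exact Finset.prod_le_one' fun t _ => h1 t
  have hmarkov := mul_meas_ge_le_lintegral (μ := Measure.pi fun _ : Fin k => ρ)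
    (f := fun x => ∏ t, ENNReal.ofReal (Real.exp (h t (x t)))) (by fun_prop)
    (ENNReal.ofReal (Real.exp τ))
  rw [Real.exp_neg, ENNReal.ofReal_inv_of_pos (Real.exp_pos _), ← one_div,
    ENNReal.le_div_iff_mul_le (Or.inl hpos) (Or.inl ENNReal.ofReal_ne_top), mul_comm]
  refine le_trans (mul_le_mul_right (measure_mono fun x hx => ?_) _) (hmarkov.trans hle)
  change _ ≤ ∏ t, ENNReal.ofReal (Real.exp (h t (x t)))
  rw [← ENNReal.ofReal_prod_of_nonneg fun _ _ => Real.exp_nonneg _, ← Real.exp_sum]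
  exact ENNReal.ofReal_le_ofReal (Real.exp_le_exp.2 hx)

section Zip

variable {A B E : Type*} [MeasurableSpace A] [MeasurableSpace B] [MeasurableSpace E]

theorem measurePreserving_zip (μ : Measure A) [IsProbabilityMeasure μ] (ν : Measure B)
    [IsProbabilityMeasure ν] (ι : Type*) [Fintype ι] :
    MeasurePreserving (fun (x : (ι → A) × (ι → B)) t => (x.1 t, x.2 t))
      ((Measure.pi fun _ => μ).prod (Measure.pi fun _ => ν))
      (Measure.pi fun _ => μ.prod ν) :=
  (measurePreserving_arrowProdEquivProdArrow A B ι (fun _ => μ) (fun _ => ν)).symm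

theorem measurePreserving_zip₃ (μ : Measure A) [IsProbabilityMeasure μ] (ν : Measure B)
    [IsProbabilityMeasure ν] (η : Measure E) [IsProbabilityMeasure η] (ι : Type*) [Fintype ι] :
    MeasurePreserving (fun (x : (ι → A) × ((ι → B) × (ι → E))) t => (x.1 t, x.2.1 t, x.2.2 t))
      ((Measure.pi fun _ => μ).prod ((Measure.pi fun _ => ν).prod (Measure.pi fun _ => η)))
      (Measure.pi fun _ => μ.prod (ν.prod η)) :=
  (measurePreserving_zip μ (ν.prod η) ι).comp
    ((MeasurePreserving.id _).prod (measurePreserving_zip ν η ι))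

theorem pair_chernoff (μ : Measure A) [IsProbabilityMeasure μ] (ν : Measure B)
    [IsProbabilityMeasure ν] {k : ℕ} {h : Fin k → A × B → ℝ} (hm : ∀ t, Measurable (h t))
    (h1 : ∀ t, ∫⁻ x, ENNReal.ofReal (Real.exp (h t x)) ∂(μ.prod ν) ≤ 1) (τ : ℝ) :
    ((Measure.pi fun _ : Fin k => μ).prod (Measure.pi fun _ : Fin k => ν))
        {x | τ ≤ ∑ t, h t (x.1 t, x.2 t)}
      ≤ ENNReal.ofReal (Real.exp (-τ)) := by
  refine le_trans (le_of_eq ?_) (pi_chernoff (μ.prod ν) hm h1 τ)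
  exact (measurePreserving_zip μ ν (Fin k)).measure_preimage
    (s := {x | τ ≤ ∑ t, h t (x t)})
    (measurableSet_le measurable_const (by fun_prop)).nullMeasurableSet

end Zip

/-- An average below τ deviates from I by at least I - τ. This dominates the indicator of a missed
threshold by an L¹ deviation, which the law of large numbers controls. -/
theorem one_le_mul_enorm_of_lt {k : ℕ} (hk : 0 < k) {s I τ : ℝ} (hτ : τ < I) (hs : s < k * τ) :
    1 ≤ ENNReal.ofReal ((I - τ)⁻¹) * ‖(k : ℝ)⁻¹ * s - I‖ₑ := by
  have hk' : (0 : ℝ) < k := by exact_mod_cast hk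
  have hpos : 0 < I - τ := sub_pos.2 hτ
  have hle : (k : ℝ)⁻¹ * s ≤ τ := by
    rw [inv_mul_le_iff₀ hk']
    exact hs.le
  rw [Real.enorm_eq_ofReal_abs, ← ENNReal.ofReal_mul (by positivity), ENNReal.one_le_ofReal,
    inv_mul_eq_div, one_le_div hpos, abs_sub_comm]
  exact (sub_le_sub_left hle I).trans (le_abs_self _)

theorem ceil_exp_pos (x : ℝ) : 0 < ⌈Real.exp x⌉₊ := Nat.ceil_pos.2 (Real.exp_pos x)

theorem ceil_exp_le {x : ℝ} (hx : 0 ≤ x) : (⌈Real.exp x⌉₊ : ℝ) ≤ 2 * Real.exp x := by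
  have h1 := (Nat.ceil_lt_add_one (Real.exp_nonneg x)).le
  have h2 := Real.one_le_exp hx
  linarith

theorem tendsto_ofReal_const_mul_exp (C : ℝ) {c : ℝ} (hc : c < 0) :
    Tendsto (fun k : ℕ => ENNReal.ofReal (C * Real.exp (k * c))) atTop (𝓝 0) := by
  have h : Tendsto (fun k : ℕ => C * Real.exp (k * c)) atTop (𝓝 (C * 0)) :=
    (Real.tendsto_exp_atBot.comp
      (tendsto_natCast_atTop_atTop.atTop_mul_const_of_neg hc)).const_mul C
  rw [mul_zero] at h
  simpa [Function.comp_def] using (ENNReal.continuous_ofReal.tendsto 0).comp h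

section Block

variable {A B E Y : Type*} [MeasurableSpace A] [MeasurableSpace B] [MeasurableSpace E]
  [MeasurableSpace Y]

open Classical in
/-- Coding theorem for a memoryless channel with two transmitters whose information densities are
bounded below in the mean by `I₁`, `I₂`, `I`: rates below these bounds are achieved, and the
empirical averages of the cost functions `p₁`, `p₂` concentrate. -/
theorem exists_block_codes (μ : Measure A) [IsProbabilityMeasure μ] (ν : Measure B)
    [IsProbabilityMeasure ν] (η : Measure E) [IsProbabilityMeasure η] {f : A → B → E → Y}
    (hf : Measurable fun q : A × (B × E) => f q.1 q.2.1 q.2.2) {g₁ g₂ g : A × (B × Y) → ℝ}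
    (hg₁ : Measurable g₁) (hg₂ : Measurable g₂) (hg : Measurable g)
    (h₁ : ∀ b y, ∫⁻ a, ENNReal.ofReal (Real.exp (g₁ (a, b, y))) ∂μ ≤ 1)
    (h₂ : ∀ a y, ∫⁻ b, ENNReal.ofReal (Real.exp (g₂ (a, b, y))) ∂ν ≤ 1)
    (h : ∀ y, ∫⁻ q, ENNReal.ofReal (Real.exp (g (q.1, q.2, y))) ∂(μ.prod ν) ≤ 1)
    (i₁ : Integrable (fun q : A × (B × E) => g₁ (q.1, q.2.1, f q.1 q.2.1 q.2.2))
      (μ.prod (ν.prod η)))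
    (i₂ : Integrable (fun q : A × (B × E) => g₂ (q.1, q.2.1, f q.1 q.2.1 q.2.2))
      (μ.prod (ν.prod η)))
    (i : Integrable (fun q : A × (B × E) => g (q.1, q.2.1, f q.1 q.2.1 q.2.2))
      (μ.prod (ν.prod η)))
    {p₁ p₂ : A × (B × E) → ℝ} (hp₁ : Measurable p₁) (hp₂ : Measurable p₂)
    (j₁ : Integrable p₁ (μ.prod (ν.prod η))) (j₂ : Integrable p₂ (μ.prod (ν.prod η)))
    {R₁ R₂ : ℝ} (hR₁ : 0 ≤ R₁) (hR₂ : 0 ≤ R₂)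
    (hI₁ : R₁ < ∫ q, g₁ (q.1, q.2.1, f q.1 q.2.1 q.2.2) ∂(μ.prod (ν.prod η)))
    (hI₂ : R₂ < ∫ q, g₂ (q.1, q.2.1, f q.1 q.2.1 q.2.2) ∂(μ.prod (ν.prod η)))
    (hI : R₁ + R₂ < ∫ q, g (q.1, q.2.1, f q.1 q.2.1 q.2.2) ∂(μ.prod (ν.prod η))) :
    ∃ (M₁ M₂ : ℕ → ℕ) (a : ∀ k, Fin (M₁ k) → Fin k → A) (b : ∀ k, Fin (M₂ k) → Fin k → B)
      (dec : ∀ k, (Fin k → Y) → Fin (M₁ k) × Fin (M₂ k)),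
      (∀ k, 0 < M₁ k) ∧ (∀ k, 0 < M₂ k) ∧ (∀ k : ℕ, Real.exp (k * R₁) ≤ M₁ k) ∧
      (∀ k : ℕ, Real.exp (k * R₂) ≤ M₂ k) ∧ (∀ k, Measurable (dec k)) ∧
      Tendsto (fun k : ℕ => ∫⁻ ω,
        ((if dec k (fun t => f (a k ω.1.1 t) (b k ω.1.2 t) (ω.2 t)) ≠ ω.1 then 1 else 0)
          + (‖(k : ℝ)⁻¹ * ∑ t, p₁ (a k ω.1.1 t, b k ω.1.2 t, ω.2 t)
                - ∫ q, p₁ q ∂(μ.prod (ν.prod η))‖ₑ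
            + ‖(k : ℝ)⁻¹ * ∑ t, p₂ (a k ω.1.1 t, b k ω.1.2 t, ω.2 t)
                - ∫ q, p₂ q ∂(μ.prod (ν.prod η))‖ₑ))
          ∂((messageLaw (M₁ k) (M₂ k)).prod (Measure.pi fun _ : Fin k => η))) atTop (𝓝 0) := by
  set ρ := μ.prod (ν.prod η) with hρ
  have hfi : Measurable fun q : A × (B × E) => (q.1, q.2.1, f q.1 q.2.1 q.2.2) :=
    measurable_fst.prodMk (measurable_snd.fst.prodMk hf)
  set G₁ : A × (B × E) → ℝ := fun q => g₁ (q.1, q.2.1, f q.1 q.2.1 q.2.2) with hG₁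
  set G₂ : A × (B × E) → ℝ := fun q => g₂ (q.1, q.2.1, f q.1 q.2.1 q.2.2) with hG₂
  set G : A × (B × E) → ℝ := fun q => g (q.1, q.2.1, f q.1 q.2.1 q.2.2) with hG
  -- Each threshold lies strictly between rate and information: the gap to the rate kills the union
  -- bound, the gap to the information makes the sent pair pass.
  obtain ⟨τ₁, hτ₁, hτ₁'⟩ := exists_between hI₁
  obtain ⟨τ₂, hτ₂, hτ₂'⟩ := exists_between hI₂
  obtain ⟨τ, hτ, hτ'⟩ := exists_between hI
  set M₁ : ℕ → ℕ := fun k => ⌈Real.exp (k * R₁)⌉₊ with hM₁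
  set M₂ : ℕ → ℕ := fun k => ⌈Real.exp (k * R₂)⌉₊ with hM₂
  let dev : (A × (B × E) → ℝ) → ∀ k : ℕ, (Fin k → A) × ((Fin k → B) × (Fin k → E)) → ℝ≥0∞ :=
    fun q k x => ‖(k : ℝ)⁻¹ * ∑ t, q (x.1 t, x.2.1 t, x.2.2 t) - ∫ y, q y ∂ρ‖ₑ
  let prodLaw : ∀ k : ℕ, Measure ((Fin k → A) × ((Fin k → B) × (Fin k → E))) := fun k =>
    (Measure.pi fun _ => μ).prod ((Measure.pi fun _ => ν).prod (Measure.pi fun _ => η))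
  have hdev_m : ∀ {q : A × (B × E) → ℝ}, Measurable q → ∀ k, Measurable (dev q k) :=
    fun hq k => by fun_prop
  have hdev : ∀ {q : A × (B × E) → ℝ}, Measurable q → Integrable q ρ →
      Tendsto (fun k => ∫⁻ x, dev q k x ∂prodLaw k) atTop (𝓝 0) := by
    intro q hq hqi
    refine (tendsto_lintegral_average_sub ρ hq hqi).congr fun k => ?_
    rw [← (measurePreserving_zip₃ μ ν η (Fin k)).lintegral_comp (by fun_prop)]
  let T : ∀ k : ℕ, Set ((Fin k → A) × ((Fin k → B) × (Fin k → Y))) := fun k =>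
    {x | k * τ₁ ≤ ∑ t, g₁ (x.1 t, x.2.1 t, x.2.2 t)} ∩
      ({x | k * τ₂ ≤ ∑ t, g₂ (x.1 t, x.2.1 t, x.2.2 t)} ∩
        {x | k * τ ≤ ∑ t, g (x.1 t, x.2.1 t, x.2.2 t)})
  have hT : ∀ k, MeasurableSet (T k) := fun k =>
    (measurableSet_le measurable_const (by fun_prop)).inter
      ((measurableSet_le measurable_const (by fun_prop)).inter
        (measurableSet_le measurable_const (by fun_prop)))
  have key : ∀ k : ℕ, _ := fun k => exists_codebook (Measure.pi fun _ : Fin k => μ)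
    (Measure.pi fun _ : Fin k => ν) (Measure.pi fun _ : Fin k => η)
    (f := fun x y e t => f (x t) (y t) (e t))
    (measurable_pi_lambda _ fun t => hf.comp
      (f := fun q : (Fin k → A) × ((Fin k → B) × (Fin k → E)) => (q.1 t, q.2.1 t, q.2.2 t))
      (by fun_prop)) (hT k)
    (p := fun x => dev p₁ k x + dev p₂ k x) ((hdev_m hp₁ k).add (hdev_m hp₂ k))
    (ceil_exp_pos (k * R₁)) (ceil_exp_pos (k * R₂))
    (t₁ := ENNReal.ofReal (Real.exp (-(k * τ₁)))) (t₂ := ENNReal.ofReal (Real.exp (-(k * τ₂))))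
    (t := ENNReal.ofReal (Real.exp (-(k * τ))))
    (fun b y => (measure_mono fun x hx => hx.1).trans
      (pi_chernoff μ (h := fun t x => g₁ (x, b t, y t)) (fun t => by fun_prop)
        (fun t => h₁ _ _) _))
    (fun a y => (measure_mono fun x hx => hx.2.1).trans
      (pi_chernoff ν (h := fun t x => g₂ (a t, x, y t)) (fun t => by fun_prop)
        (fun t => h₂ _ _) _))
    (fun y => (measure_mono fun x hx => hx.2.2).trans
      (pair_chernoff μ ν (h := fun t x => g (x.1, x.2, y t)) (fun t => by fun_prop)
        (fun t => h _) _))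
  choose a b dec hdec hcost using key
  refine ⟨M₁, M₂, a, b, dec, fun k => ceil_exp_pos _, fun k => ceil_exp_pos _,
    fun k => Nat.le_ceil _, fun k => Nat.le_ceil _, hdec, ?_⟩
  let c₁ := ENNReal.ofReal ((∫ q, G₁ q ∂ρ - τ₁)⁻¹)
  let c₂ := ENNReal.ofReal ((∫ q, G₂ q ∂ρ - τ₂)⁻¹)
  let c := ENNReal.ofReal ((∫ q, G q ∂ρ - τ)⁻¹)
  have hG₁m : Measurable G₁ := hg₁.comp hfi
  have hG₂m : Measurable G₂ := hg₂.comp hfi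
  have hGm : Measurable G := hg.comp hfi
  -- The factors 2 and 4 = 2·2 absorb the rounding up of the codebook sizes, one factor 2 per
  -- codebook.
  have hlim : Tendsto (fun k : ℕ => c₁ * ∫⁻ x, dev G₁ k x ∂prodLaw k
      + (c₂ * ∫⁻ x, dev G₂ k x ∂prodLaw k + (c * ∫⁻ x, dev G k x ∂prodLaw k
      + (∫⁻ x, dev p₁ k x ∂prodLaw k + ∫⁻ x, dev p₂ k x ∂prodLaw k)))
      + ENNReal.ofReal (2 * Real.exp (k * (R₁ - τ₁))) + ENNReal.ofReal (2 * Real.exp (k * (R₂ - τ₂)))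
      + ENNReal.ofReal (4 * Real.exp (k * (R₁ + R₂ - τ)))) atTop (𝓝 0) := by
    have e₁ := ENNReal.Tendsto.const_mul (a := c₁) (hdev hG₁m i₁) (Or.inr ENNReal.ofReal_ne_top)
    have e₂ := ENNReal.Tendsto.const_mul (a := c₂) (hdev hG₂m i₂) (Or.inr ENNReal.ofReal_ne_top)
    have e := ENNReal.Tendsto.const_mul (a := c) (hdev hGm i) (Or.inr ENNReal.ofReal_ne_top)
    simpa using (((e₁.add (e₂.add (e.add ((hdev hp₁ j₁).add (hdev hp₂ j₂))))).add
      (tendsto_ofReal_const_mul_exp 2 (sub_neg.2 hτ₁))).add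
      (tendsto_ofReal_const_mul_exp 2 (sub_neg.2 hτ₂))).add
      (tendsto_ofReal_const_mul_exp 4 (sub_neg.2 hτ))
  have hunion : ∀ {k : ℕ} {R τ : ℝ}, 0 ≤ R →
      (⌈Real.exp (k * R)⌉₊ : ℝ≥0∞) * ENNReal.ofReal (Real.exp (-(k * τ)))
        ≤ ENNReal.ofReal (2 * Real.exp (k * (R - τ))) := by
    intro k R τ hR
    rw [← ENNReal.ofReal_natCast, ← ENNReal.ofReal_mul (Nat.cast_nonneg _)]
    refine ENNReal.ofReal_le_ofReal ?_
    refine (mul_le_mul_of_nonneg_right (ceil_exp_le (by positivity))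
      (Real.exp_nonneg _)).trans (le_of_eq ?_)
    rw [mul_assoc, ← Real.exp_add]
    congr 2
    ring
  refine tendsto_of_tendsto_of_tendsto_of_le_of_le' tendsto_const_nhds hlim
    (Eventually.of_forall fun _ => zero_le) ((eventually_gt_atTop 0).mono fun k hk => ?_)
  refine (hcost k).trans ?_
  gcongr
  · rw [← lintegral_const_mul _ (hdev_m hG₁m k), ← lintegral_const_mul _ (hdev_m hG₂m k),
      ← lintegral_const_mul _ (hdev_m hGm k), ← lintegral_add_left (hdev_m hp₁ k),
      ← lintegral_add_left ((hdev_m hGm k).const_mul _),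
      ← lintegral_add_left ((hdev_m hG₂m k).const_mul _),
      ← lintegral_add_left ((hdev_m hG₁m k).const_mul _)]
    refine lintegral_mono fun x => ?_
    simp only [← add_assoc]
    gcongr
    split_ifs with hx
    · exact zero_le
    · by_cases hx₁ : k * τ₁ ≤ ∑ t, G₁ (x.1 t, x.2.1 t, x.2.2 t)
      · by_cases hx₂ : k * τ₂ ≤ ∑ t, G₂ (x.1 t, x.2.1 t, x.2.2 t)
        · have hx₃ : ∑ t, G (x.1 t, x.2.1 t, x.2.2 t) < k * τ :=
            not_le.1 fun h' => hx ⟨hx₁, hx₂, h'⟩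
          exact le_add_left (one_le_mul_enorm_of_lt hk hτ' hx₃)
        · exact le_add_right (le_add_left (one_le_mul_enorm_of_lt hk hτ₂' (not_le.1 hx₂)))
      · exact le_add_right (le_add_right (one_le_mul_enorm_of_lt hk hτ₁' (not_le.1 hx₁)))
  · exact hunion hR₁
  · exact hunion hR₂
  · rw [← ENNReal.ofReal_natCast, ← ENNReal.ofReal_natCast, ← ENNReal.ofReal_mul (by positivity),
      ← ENNReal.ofReal_mul (by positivity)]
    refine ENNReal.ofReal_le_ofReal ?_
    refine (mul_le_mul_of_nonneg_right (mul_le_mul (ceil_exp_le (by positivity))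
      (ceil_exp_le (by positivity)) (by positivity) (by positivity))
      (Real.exp_nonneg _)).trans (le_of_eq ?_)
    rw [show (4 : ℝ) * Real.exp (k * (R₁ + R₂ - τ)) = (2 * 2) * Real.exp (k * R₁ + k * R₂ + -(k * τ))
      by ring_nf, Real.exp_add, Real.exp_add]
    ring

end Block

/-! ### Power constraints in terms of real second moments -/

instance isProbabilityMeasure_noiseLaw (n : ℕ) (v : ℝ≥0) : IsProbabilityMeasure (noiseLaw n v) := by
  unfold noiseLaw; infer_instance

theorem powerConstraint_iff {Ω : Type*} [MeasurableSpace Ω] {μ : Measure Ω} {n : ℕ} (hn : 0 < n)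
    {X : Fin n → Ω → ℝ} (hX : ∀ t, Integrable (fun ω => X t ω ^ 2) μ) (P : ℝ≥0) :
    PowerConstraint μ X P ↔ ∑ t, ∫ ω, X t ω ^ 2 ∂μ ≤ n * P := by
  have hn' : (n : ℝ≥0∞) ≠ 0 := by exact_mod_cast hn.ne'
  have hsum : ∑ t, ∫⁻ ω, ENNReal.ofReal (X t ω ^ 2) ∂μ
      = ENNReal.ofReal (∑ t, ∫ ω, X t ω ^ 2 ∂μ) := by
    rw [ENNReal.ofReal_sum_of_nonneg fun t _ => integral_nonneg fun ω => sq_nonneg _]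
    exact Finset.sum_congr rfl fun t _ =>
      (ofReal_integral_eq_lintegral_ofReal (hX t) (ae_of_all _ fun ω => sq_nonneg _)).symm
  rw [PowerConstraint, hsum, mul_comm, ← div_eq_mul_inv,
    ENNReal.div_le_iff_le_mul (Or.inl hn') (Or.inl (ENNReal.natCast_ne_top n)),
    show (P : ℝ≥0∞) * n = ENNReal.ofReal (n * P) by
      rw [ENNReal.ofReal_mul (Nat.cast_nonneg n), ENNReal.ofReal_natCast,
        ENNReal.ofReal_coe_nnreal, mul_comm]]
  exact ENNReal.ofReal_le_ofReal_iff (by positivity)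

/-! ### Feedback does not hurt -/

namespace NoFeedbackCode

variable {n : ℕ} (c : NoFeedbackCode n)

/-- The code that ignores the feedback. -/
def ignoreFeedback : PartialFeedbackCode n where
  size₁ := c.size₁
  size₂ := c.size₂
  size₁_pos := c.size₁_pos
  size₂_pos := c.size₂_pos
  enc₁ := c.enc₁
  enc₂ t m _ := c.enc₂ t m
  measurable_enc₂ _ _ := measurable_const
  dec := c.dec
  measurable_dec := c.measurable_dec

theorem isProbabilityMeasure_law (N : ℝ≥0) : IsProbabilityMeasure (c.law N) := by
  have := isProbabilityMeasure_messageLaw c.size₁_pos c.size₂_pos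
  unfold law; infer_instance

theorem measurePreserving_forget (N σsq : ℝ≥0) :
    MeasurePreserving (fun ω : c.ignoreFeedback.Outcome => ((ω.1, ω.2.1) : c.Outcome))
      (c.ignoreFeedback.law N σsq) (c.law N) := by
  have := isProbabilityMeasure_messageLaw c.size₁_pos c.size₂_pos
  exact (MeasurePreserving.id (messageLaw c.size₁ c.size₂)).prod
    (measurePreserving_fst (μ := noiseLaw n N) (ν := noiseLaw n σsq))

theorem measurable_input₁ (t : Fin n) : Measurable (c.input₁ t) :=
  (measurable_of_finite (c.enc₁ t)).comp measurable_fst.fst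

theorem measurable_input₂ (t : Fin n) : Measurable (c.input₂ t) :=
  (measurable_of_finite (c.enc₂ t)).comp measurable_fst.snd

theorem measurable_output : Measurable c.output :=
  measurable_pi_lambda _ fun t => ((c.measurable_input₁ t).add (c.measurable_input₂ t)).add
    ((measurable_pi_apply t).comp measurable_snd)

theorem measurableSet_error : MeasurableSet {ω | c.dec (c.output ω) ≠ ω.1} :=
  (measurableSet_eq_fun (c.measurable_dec.comp c.measurable_output) measurable_fst).compl

theorem ignoreFeedback_output (ω : c.ignoreFeedback.Outcome) :
    c.ignoreFeedback.output ω = c.output (ω.1, ω.2.1) := by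
  funext t
  rw [PartialFeedbackCode.output_eq]
  rfl

theorem ignoreFeedback_admissible {P₁ P₂ N : ℝ≥0} (σsq : ℝ≥0) (h : c.Admissible P₁ P₂ N) :
    c.ignoreFeedback.Admissible P₁ P₂ N σsq := by
  have hmp := c.measurePreserving_forget N σsq
  constructor
  · refine le_trans (le_of_eq ?_) h.1
    congr 1
    exact Finset.sum_congr rfl fun t _ =>
      hmp.lintegral_comp ((c.measurable_input₁ t).pow_const 2).ennreal_ofReal
  · refine le_trans (le_of_eq ?_) h.2
    congr 1
    exact Finset.sum_congr rfl fun t _ =>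
      hmp.lintegral_comp ((c.measurable_input₂ t).pow_const 2).ennreal_ofReal

theorem ignoreFeedback_errorProb (N σsq : ℝ≥0) :
    c.ignoreFeedback.errorProb N σsq = c.errorProb N := by
  have h := (c.measurePreserving_forget N σsq).measure_preimage
    c.measurableSet_error.nullMeasurableSet
  refine Eq.trans ?_ h
  unfold PartialFeedbackCode.errorProb
  congr 1
  ext ω
  simp only [ignoreFeedback_output]
  rfl

end NoFeedbackCode

theorem capacityMAC_subset_capacityPartialFB (P₁ P₂ N σsq : ℝ≥0) :
    capacityMAC P₁ P₂ N ⊆ capacityPartialFB P₁ P₂ N σsq := by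
  rintro R ⟨h₁, h₂, h⟩
  refine ⟨h₁, h₂, fun δ hδ => ?_⟩
  obtain ⟨c, hc, herr⟩ := h δ hδ
  refine ⟨fun n => (c n).ignoreFeedback, ?_, ?_⟩
  · filter_upwards [hc] with n hn
    exact ⟨(c n).ignoreFeedback_admissible σsq hn.1, hn.2⟩
  · simpa only [NoFeedbackCode.ignoreFeedback_errorProb] using herr

/-! ### The converse without feedback -/

/-- Jensen's inequality, from integrating x + 1 ≤ exp x at x = G - log K. -/
theorem integral_le_of_lintegral_exp_le {Ω : Type*} [MeasurableSpace Ω] {ρ : Measure Ω}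
    [IsProbabilityMeasure ρ] {G : Ω → ℝ} (hG : Integrable G ρ) {K : ℝ} (hK : 0 < K)
    (h : ∫⁻ ω, ENNReal.ofReal (Real.exp (G ω)) ∂ρ ≤ ENNReal.ofReal K) :
    ∫ ω, G ω ∂ρ ≤ Real.log K := by
  have hm : AEStronglyMeasurable (fun ω => Real.exp (G ω)) ρ :=
    Real.continuous_exp.comp_aestronglyMeasurable hG.1
  have hi : Integrable (fun ω => Real.exp (G ω)) ρ := by
    refine (lintegral_ofReal_ne_top_iff_integrable hm (ae_of_all _ fun ω => Real.exp_nonneg _)).1 ?_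
    exact (h.trans_lt ENNReal.ofReal_lt_top).ne
  have hle : ∫ ω, Real.exp (G ω) ∂ρ ≤ K := by
    rw [integral_eq_lintegral_of_nonneg_ae (ae_of_all _ fun ω => Real.exp_nonneg _) hm]
    exact ENNReal.toReal_le_of_le_ofReal hK.le h
  have hmono : ∫ ω, (G ω + (1 - Real.log K)) ∂ρ ≤ ∫ ω, Real.exp (G ω) * K⁻¹ ∂ρ := by
    refine integral_mono (hG.add (integrable_const _)) (hi.mul_const _) fun ω => ?_
    have := Real.add_one_le_exp (G ω - Real.log K)
    rw [Real.exp_sub, Real.exp_log hK, div_eq_mul_inv] at this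
    change G ω + (1 - Real.log K) ≤ Real.exp (G ω) * K⁻¹
    linarith
  rw [integral_add hG (integrable_const _), integral_mul_const, integral_const, probReal_univ,
    one_smul] at hmono
  have : (∫ ω, Real.exp (G ω) ∂ρ) * K⁻¹ ≤ 1 := by
    rw [← div_eq_mul_inv, div_le_one hK]
    exact hle
  linarith

theorem lintegral_gaussianReal_shift {N S : ℝ≥0} (hN : 0 < N) (hS : 0 < S) (x m : ℝ)
    {h : ℝ → ℝ≥0∞} (hh : Measurable h) :
    ∫⁻ z, ENNReal.ofReal (Real.exp (logDensity S (x + z - m) - logDensity N z)) * h (x + z)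
      ∂gaussianReal 0 N = ∫⁻ y, h y ∂gaussianReal m S := by
  have hm := measurable_logDensity
  rw [lintegral_gaussianReal hN 0 (by fun_prop), lintegral_gaussianReal hS m hh,
    ← lintegral_add_left_eq_self (fun y => ENNReal.ofReal (Real.exp (logDensity S (y - m))) * h y) x]
  refine lintegral_congr fun z => ?_
  rw [← mul_assoc, ← ENNReal.ofReal_mul (Real.exp_nonneg _), ← Real.exp_add, sub_zero,
    add_sub_cancel]

/-- The exponential is the likelihood ratio between a reference output law and the true output law
for the input `x`. Under the reference law on the right the dependence on `x`, hence on the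
messages, has disappeared. -/
theorem lintegral_noiseLaw_shift {n : ℕ} {N S : ℝ≥0} (hN : 0 < N) (hS : 0 < S) (x m : Fin n → ℝ)
    {h : (Fin n → ℝ) → ℝ≥0∞} (hh : Measurable h) :
    ∫⁻ z, ENNReal.ofReal (Real.exp (∑ t, (logDensity S (x t + z t - m t) - logDensity N (z t))))
        * h (fun t => x t + z t) ∂noiseLaw n N
      = ∫⁻ y, h y ∂Measure.pi fun t => gaussianReal (m t) S := by
  have hm := measurable_logDensity
  set Λ : (Fin n → ℝ) → ℝ≥0∞ := fun z =>
    ENNReal.ofReal (Real.exp (∑ t, (logDensity S (x t + z t - m t) - logDensity N (z t)))) with hΛ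
  have hΛm : Measurable Λ := by fun_prop
  have hs : Measurable fun (z : Fin n → ℝ) t => x t + z t := by fun_prop
  have hlaw : (Measure.pi fun t => gaussianReal (m t) S)
      = ((noiseLaw n N).withDensity Λ).map fun z t => x t + z t := by
    -- Equality on boxes suffices, and there both the likelihood ratio and the indicator factorise.
    refine Measure.pi_eq fun s hsm => ?_
    have hbox : MeasurableSet ((fun (z : Fin n → ℝ) t => x t + z t) ⁻¹' Set.univ.pi s) :=
      hs (MeasurableSet.univ_pi hsm)
    rw [Measure.map_apply hs (MeasurableSet.univ_pi hsm), withDensity_apply _ hbox,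
      ← lintegral_indicator hbox]
    have hfac : ∀ z : Fin n → ℝ,
        ((fun (z : Fin n → ℝ) t => x t + z t) ⁻¹' Set.univ.pi s).indicator Λ z
          = ∏ t, ENNReal.ofReal (Real.exp (logDensity S (x t + z t - m t) - logDensity N (z t)))
              * (s t).indicator 1 (x t + z t) := by
      intro z
      rw [Finset.prod_mul_distrib, ← ENNReal.ofReal_prod_of_nonneg fun _ _ => Real.exp_nonneg _,
        ← Real.exp_sum]
      by_cases hz : ∀ t, x t + z t ∈ s t
      · rw [Set.indicator_of_mem (by simpa using hz),
          Finset.prod_eq_one fun t _ => Set.indicator_of_mem (hz t) _, mul_one]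
      · rw [Set.indicator_of_notMem (by simpa using hz)]
        push Not at hz
        obtain ⟨t, ht⟩ := hz
        rw [Finset.prod_eq_zero (Finset.mem_univ t) (Set.indicator_of_notMem ht _), mul_zero]
    simp only [hfac]
    rw [noiseLaw, lintegral_pi_prod_eq (fun _ => gaussianReal 0 N)
      (f := fun t z => ENNReal.ofReal (Real.exp (logDensity S (x t + z - m t) - logDensity N z))
              * (s t).indicator 1 (x t + z))]
    · refine Finset.prod_congr rfl fun t _ => ?_
      rw [lintegral_gaussianReal_shift hN hS _ _ (measurable_one.indicator (hsm t)),
        lintegral_indicator_one (hsm t)]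
    · exact fun t => Measurable.mul (by fun_prop)
        ((measurable_one.indicator (hsm t)).comp (measurable_const_add (x t)))
  rw [hlaw, lintegral_map hh hs, lintegral_withDensity_eq_lintegral_mul _ hΛm
    (g := fun z => h fun t => x t + z t) (hh.comp hs)]
  rfl

theorem messageLaw_singleton {k₁ k₂ : ℕ} (m : Fin k₁ × Fin k₂) :
    messageLaw k₁ k₂ {m} = (k₁ : ℝ≥0∞)⁻¹ * (k₂ : ℝ≥0∞)⁻¹ := by
  have : Nonempty (Fin k₁) := ⟨m.1⟩
  have : Nonempty (Fin k₂) := ⟨m.2⟩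
  rw [messageLaw, ← Set.singleton_prod_singleton, Measure.prod_prod, uniformOn_univ,
    uniformOn_univ]
  simp

namespace NoFeedbackCode

variable {n : ℕ} (c : NoFeedbackCode n)

-- With M the number of message pairs, changing measure bounds the contribution of message pair i by
-- M · Q(dec = i) + 1. The decoding sets partition the output space, so the average over messages is
-- at most 1 + 1. The bound 2 becomes the term log 2 of Fano's inequality.
open Classical in
theorem lintegral_exp_density_le {N S : ℝ≥0} (hN : 0 < N) (hS : 0 < S) (m : Fin n → ℝ) :
    ∫⁻ ω, ENNReal.ofReal (Real.exp
        ((if c.dec (c.output ω) = ω.1 then Real.log (c.size₁ * c.size₂) else 0)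
          + ∑ t, (logDensity S (c.output ω t - m t) - logDensity N (ω.2 t)))) ∂c.law N
      ≤ 2 := by
  have := isProbabilityMeasure_messageLaw c.size₁_pos c.size₂_pos
  have hs₁ : (0 : ℝ) < c.size₁ := by exact_mod_cast c.size₁_pos
  have hs₂ : (0 : ℝ) < c.size₂ := by exact_mod_cast c.size₂_pos
  have hm := measurable_logDensity
  have hout := c.measurable_output
  set Q := Measure.pi fun t => gaussianReal (m t) S with hQ
  have hD : ∀ i, MeasurableSet {y | c.dec y = i} := fun i =>
    c.measurable_dec (measurableSet_singleton i)
  have hslice : ∀ i : Fin c.size₁ × Fin c.size₂, ∫⁻ z, ENNReal.ofReal (Real.exp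
        ((if c.dec (c.output (i, z)) = i then Real.log (c.size₁ * c.size₂) else 0)
          + ∑ t, (logDensity S (c.output (i, z) t - m t) - logDensity N (z t)))) ∂noiseLaw n N
      ≤ c.size₁ * c.size₂ * Q {y | c.dec y = i} + 1 := by
    intro i
    have h := lintegral_noiseLaw_shift hN hS (fun t => c.enc₁ t i.1 + c.enc₂ t i.2) m
      (h := fun y => if c.dec y = i then (c.size₁ * c.size₂ : ℝ≥0∞) else 1)
      (Measurable.ite (hD i) measurable_const measurable_const)
    refine (le_of_eq (Eq.trans (lintegral_congr fun z => ?_) h)).trans ?_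
    · rw [Real.exp_add, ENNReal.ofReal_mul (Real.exp_nonneg _), mul_comm]
      congr 1
      change _ = if c.dec (c.output (i, z)) = i then _ else _
      split_ifs
      · rw [Real.exp_log (by positivity), ENNReal.ofReal_mul hs₁.le, ENNReal.ofReal_natCast,
          ENNReal.ofReal_natCast]
      · simp
    · calc ∫⁻ y, (if c.dec y = i then (c.size₁ * c.size₂ : ℝ≥0∞) else 1) ∂Q
          ≤ ∫⁻ y, ({y | c.dec y = i}.indicator (fun _ => (c.size₁ * c.size₂ : ℝ≥0∞)) y + 1) ∂Q := by
            refine lintegral_mono fun y => ?_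
            by_cases hy : c.dec y = i
            · simp [hy]
            · simp [hy]
        _ = c.size₁ * c.size₂ * Q {y | c.dec y = i} + 1 := by
            rw [lintegral_add_right _ measurable_const, lintegral_indicator_const (hD i)]
            simp
  have hmeas : Measurable fun ω : c.Outcome => ENNReal.ofReal (Real.exp
        ((if c.dec (c.output ω) = ω.1 then Real.log (c.size₁ * c.size₂) else 0)
          + ∑ t, (logDensity S (c.output ω t - m t) - logDensity N (ω.2 t)))) := by
    refine (Measurable.exp (Measurable.add (Measurable.ite ?_ measurable_const measurable_const)
      (Finset.measurable_fun_sum _ fun t _ => ?_))).ennreal_ofReal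
    · exact measurableSet_eq_fun (c.measurable_dec.comp hout) measurable_fst
    · exact ((hm S).comp (((measurable_pi_apply t).comp hout).sub_const _)).sub
        ((hm N).comp ((measurable_pi_apply t).comp measurable_snd))
  rw [law, lintegral_prod _ hmeas.aemeasurable]
  refine (lintegral_mono hslice).trans ?_
  rw [lintegral_add_right _ measurable_const, lintegral_fintype]
  simp only [messageLaw_singleton, lintegral_const, measure_univ, mul_one]
  have hsum : ∑ i, Q {y | c.dec y = i} = 1 := by
    have h := sum_measure_preimage_singleton (μ := Q) Finset.univ (f := c.dec)
      fun i _ => hD i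
    simp only [Finset.coe_univ, Set.preimage_univ, measure_univ] at h
    exact h
  have hterm : ∀ i : Fin c.size₁ × Fin c.size₂,
      (c.size₁ * c.size₂ * Q {y | c.dec y = i}) * ((c.size₁ : ℝ≥0∞)⁻¹ * (c.size₂ : ℝ≥0∞)⁻¹)
        = Q {y | c.dec y = i} := by
    intro i
    have e₁ : (c.size₁ : ℝ≥0∞) * (c.size₁ : ℝ≥0∞)⁻¹ = 1 :=
      ENNReal.mul_inv_cancel (by exact_mod_cast c.size₁_pos.ne') (ENNReal.natCast_ne_top _)
    have e₂ : (c.size₂ : ℝ≥0∞) * (c.size₂ : ℝ≥0∞)⁻¹ = 1 :=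
      ENNReal.mul_inv_cancel (by exact_mod_cast c.size₂_pos.ne') (ENNReal.natCast_ne_top _)
    calc _ = ((c.size₁ : ℝ≥0∞) * (c.size₁ : ℝ≥0∞)⁻¹) * ((c.size₂ : ℝ≥0∞) * (c.size₂ : ℝ≥0∞)⁻¹)
          * Q {y | c.dec y = i} := by ring
      _ = _ := by rw [e₁, e₂, one_mul, one_mul]
  rw [Finset.sum_congr rfl fun i _ => hterm i, hsum, one_add_one_eq_two]

open Classical in
/-- Fano's inequality combined with the Gaussian bound on the mutual information. -/
theorem log_size_mul_le {P₁ P₂ N : ℝ≥0} (hN : 0 < N) (hn : 0 < n) (h : c.Admissible P₁ P₂ N) :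
    Real.log (c.size₁ * c.size₂) * (1 - (c.errorProb N).toReal)
      ≤ n * (1 / 2 * Real.log (1 + ((P₁ : ℝ) + P₂) / N)) + Real.log 2 := by
  have := Fin.pos_iff_nonempty.1 c.size₁_pos
  have := Fin.pos_iff_nonempty.1 c.size₂_pos
  have := isProbabilityMeasure_messageLaw c.size₁_pos c.size₂_pos
  have := c.isProbabilityMeasure_law N
  have hN' : (0 : ℝ) < N := hN
  set S : ℝ≥0 := P₁ + P₂ + N with hS
  have hSpos : 0 < S := by positivity
  have hS' : (0 : ℝ) < S := hSpos
  set ρ₁ : Measure (Fin c.size₁) := uniformOn Set.univ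
  set ρ₂ : Measure (Fin c.size₂) := uniformOn Set.univ
  let v₁ : Fin n → ℝ := fun t => Var[c.enc₁ t; ρ₁]
  let v₂ : Fin n → ℝ := fun t => Var[c.enc₂ t; ρ₂]
  -- Centring the reference law at the true output means leaves only the variances of the inputs,
  -- which are at most their second moments.
  let m : Fin n → ℝ := fun t => ∫ i, c.enc₁ t i ∂ρ₁ + ∫ i, c.enc₂ t i ∂ρ₂
  have hcent : ∀ {k : ℕ} (ρ : Measure (Fin k)) [IsProbabilityMeasure ρ] (x : Fin k → ℝ),
      Centered ρ (fun i => x i - ∫ j, x j ∂ρ) (Var[x; ρ]) := by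
    intro k ρ _ x
    have hL : MemLp x 2 ρ := .of_discrete
    refine ⟨hL.sub (memLp_const _), ?_, (variance_eq_integral hL.aemeasurable).symm⟩
    rw [integral_sub Integrable.of_finite (integrable_const _)]
    simp
  have hnoise : ∀ t, Centered (noiseLaw n N) (fun z => z t) N := fun t => by
    have hmp := measurePreserving_eval (fun _ : Fin n => gaussianReal 0 N) t
    have hg := Centered.gaussianReal N
    refine ⟨hg.memLp.comp_measurePreserving hmp, ?_, ?_⟩
    · rw [← hg.mean, ← hmp.map_eq, integral_map hmp.aemeasurable (by fun_prop)]
      rfl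
    · rw [← hg.second, ← hmp.map_eq, integral_map hmp.aemeasurable (by fun_prop)]
      rfl
  have hW : ∀ t, Centered (c.law N) (fun ω => c.output ω t - m t) (v₁ t + v₂ t + N) := fun t => by
    have := ((hcent ρ₁ (c.enc₁ t)).prod (hcent ρ₂ (c.enc₂ t))).prod (hnoise t)
    refine Eq.mp (congrArg (fun F => Centered (c.law N) F _) ?_) this
    funext ω
    simp only [output, input₁, input₂, m]
    ring
  have hZ : ∀ t, Centered (c.law N) (fun ω => ω.2 t) N := fun t => by
    have h0 : Centered (messageLaw c.size₁ c.size₂) (fun _ => 0) 0 := ⟨MemLp.zero', by simp, by simp⟩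
    simpa [law] using h0.prod (hnoise t)
  have hpow₁ : ∑ t, v₁ t ≤ n * P₁ := by
    have hp := (powerConstraint_iff hn (X := c.input₁) (μ := c.law N) (fun t => ?_) P₁).1 h.1
    · refine le_trans (Finset.sum_le_sum fun t _ => ?_) hp
      refine (variance_le_expectation_sq (Measurable.aestronglyMeasurable
        (measurable_of_finite _))).trans (le_of_eq ?_)
      have e₁ : ∫ ω, c.input₁ t ω ^ 2 ∂c.law N
          = ∫ i, c.enc₁ t i.1 ^ 2 ∂messageLaw c.size₁ c.size₂ := by
        have := integral_fun_fst (μ := messageLaw c.size₁ c.size₂) (ν := noiseLaw n N)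
          fun i => c.enc₁ t i.1 ^ 2
        rw [probReal_univ, one_smul] at this
        exact this
      have e₂ : ∫ i, c.enc₁ t i.1 ^ 2 ∂messageLaw c.size₁ c.size₂ = ∫ i, c.enc₁ t i ^ 2 ∂ρ₁ := by
        have := integral_fun_fst (μ := ρ₁) (ν := ρ₂) fun i => c.enc₁ t i ^ 2
        rw [probReal_univ, one_smul] at this
        exact this
      rw [e₁, e₂]
      rfl
    · exact Integrable.comp_fst (f := fun i : Fin c.size₁ × Fin c.size₂ => c.enc₁ t i.1 ^ 2)
        .of_finite _
  have hpow₂ : ∑ t, v₂ t ≤ n * P₂ := by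
    have hp := (powerConstraint_iff hn (X := c.input₂) (μ := c.law N) (fun t => ?_) P₂).1 h.2
    · refine le_trans (Finset.sum_le_sum fun t _ => ?_) hp
      refine (variance_le_expectation_sq (Measurable.aestronglyMeasurable
        (measurable_of_finite _))).trans (le_of_eq ?_)
      have e₁ : ∫ ω, c.input₂ t ω ^ 2 ∂c.law N
          = ∫ i, c.enc₂ t i.2 ^ 2 ∂messageLaw c.size₁ c.size₂ := by
        have := integral_fun_fst (μ := messageLaw c.size₁ c.size₂) (ν := noiseLaw n N)
          fun i => c.enc₂ t i.2 ^ 2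
        rw [probReal_univ, one_smul] at this
        exact this
      have e₂ : ∫ i, c.enc₂ t i.2 ^ 2 ∂messageLaw c.size₁ c.size₂ = ∫ i, c.enc₂ t i ^ 2 ∂ρ₂ := by
        have := integral_fun_snd (μ := ρ₁) (ν := ρ₂) fun i => c.enc₂ t i ^ 2
        rw [probReal_univ, one_smul] at this
        exact this
      rw [e₁, e₂]
      rfl
    · exact Integrable.comp_fst (f := fun i : Fin c.size₁ × Fin c.size₂ => c.enc₂ t i.2 ^ 2)
        .of_finite _
  have hcorrect : MeasurableSet {ω : c.Outcome | c.dec (c.output ω) = ω.1} :=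
    measurableSet_eq_fun (c.measurable_dec.comp c.measurable_output) measurable_fst
  set F : c.Outcome → ℝ :=
    fun ω => if c.dec (c.output ω) = ω.1 then Real.log (c.size₁ * c.size₂) else 0
  have hF : F = {ω : c.Outcome | c.dec (c.output ω) = ω.1}.indicator
      fun _ => Real.log (c.size₁ * c.size₂) := by
    funext ω
    simp only [F, Set.indicator_apply, Set.mem_ofPred_eq]
  have hFi : Integrable F (c.law N) := by
    rw [hF]
    exact (integrable_const _).indicator hcorrect
  have hFe : ∫ ω, F ω ∂c.law N = Real.log (c.size₁ * c.size₂) * (1 - (c.errorProb N).toReal) := by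
    rw [hF, integral_indicator_const _ hcorrect, smul_eq_mul, mul_comm]
    congr 1
    have := probReal_compl_eq_one_sub (μ := c.law N) c.measurableSet_error
    rw [errorProb]
    refine Eq.trans ?_ this
    congr 1
    ext ω
    simp
  have hLi : ∀ t, Integrable (fun ω : c.Outcome =>
      logDensity S (c.output ω t - m t) - logDensity N (ω.2 t)) (c.law N) := fun t =>
    ((hW t).integrable_logDensity _).sub ((hZ t).integrable_logDensity _)
  have hG := integral_le_of_lintegral_exp_le (ρ := c.law N) (K := 2)
    (hFi.add (integrable_finsetSum Finset.univ fun t _ => hLi t)) two_pos (by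
      have := c.lintegral_exp_density_le hN hSpos m
      simpa [F] using this)
  have hsplit : ∫ ω, (F + fun ω => ∑ t, (logDensity S (c.output ω t - m t)
        - logDensity N (ω.2 t))) ω ∂c.law N
      = Real.log (c.size₁ * c.size₂) * (1 - (c.errorProb N).toReal)
        + ∑ t, (-(1 / 2) * Real.log (2 * Real.pi * S) - (v₁ t + v₂ t + N) / (2 * S)
          - (-(1 / 2) * Real.log (2 * Real.pi * N) - N / (2 * N))) := by
    rw [integral_add' hFi (integrable_finsetSum Finset.univ fun t _ => hLi t), hFe,
      integral_finsetSum _ fun t _ => hLi t]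
    congr 1
    refine Finset.sum_congr rfl fun t _ => ?_
    rw [integral_sub ((hW t).integrable_logDensity _) ((hZ t).integrable_logDensity _),
      (hW t).integral_logDensity, (hZ t).integral_logDensity]
  rw [hsplit] at hG
  have hlog : Real.log (1 + ((P₁ : ℝ) + P₂) / N)
      = Real.log (2 * Real.pi * S) - Real.log (2 * Real.pi * N) := by
    have hpi := Real.pi_pos
    rw [← Real.log_div (by positivity) (by positivity)]
    congr 1
    rw [hS]
    push_cast
    field_simp
    ring
  -- Since the reference variance is the same at all times, the expected log-likelihood ratio is
  -- affine in the variances. Only their total matters, and unused power enters with the favourable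
  -- sign; no concavity of the logarithm is needed.
  have hsum : ∑ t, (-(1 / 2) * Real.log (2 * Real.pi * S) - (v₁ t + v₂ t + N) / (2 * S)
          - (-(1 / 2) * Real.log (2 * Real.pi * N) - N / (2 * N)))
      = -(n * (1 / 2 * Real.log (1 + ((P₁ : ℝ) + P₂) / N)))
        + (n * (P₁ + P₂) - (∑ t, v₁ t + ∑ t, v₂ t)) / (2 * S) := by
    have e : ∀ t, -(1 / 2) * Real.log (2 * Real.pi * S) - (v₁ t + v₂ t + N) / (2 * S)
          - (-(1 / 2) * Real.log (2 * Real.pi * N) - N / (2 * N))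
        = (-(1 / 2 * Real.log (1 + ((P₁ : ℝ) + P₂) / N)) + (P₁ + P₂) / (2 * S))
          - (v₁ t + v₂ t) / (2 * S) := by
      intro t
      rw [hlog]
      have hSe : (S : ℝ) = P₁ + P₂ + N := by rw [hS]; push_cast; ring
      have : (N : ℝ) / (2 * N) = ((P₁ + P₂) + N) / (2 * S) := by
        rw [hSe]; rw [hSe] at hS'; field_simp
      rw [this]
      ring
    simp only [e]
    rw [Finset.sum_sub_distrib, ← Finset.sum_div, Finset.sum_add_distrib (f := v₁)]
    simp
    ring
  rw [hsum] at hG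
  have hnn : 0 ≤ (n * (P₁ + P₂) - (∑ t, v₁ t + ∑ t, v₂ t)) / (2 * (S : ℝ)) :=
    div_nonneg (by linarith) (by positivity)
  linarith

end NoFeedbackCode

theorem add_le_of_mem_capacityMAC {P₁ P₂ N : ℝ≥0} (hN : 0 < N) {R : ℝ × ℝ}
    (hR : R ∈ capacityMAC P₁ P₂ N) :
    R.1 + R.2 ≤ 1 / 2 * Real.log (1 + ((P₁ : ℝ) + P₂) / N) := by
  refine le_of_forall_pos_le_add fun ε hε => ?_
  obtain ⟨c, hc, herr⟩ := hR.2.2 (ε / 2) (half_pos hε)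
  have herr' : Tendsto (fun n => (R.1 + R.2 - ε) * (1 - ((c n).errorProb N).toReal)) atTop
      (𝓝 ((R.1 + R.2 - ε) * (1 - 0))) :=
    (((ENNReal.tendsto_toReal ENNReal.zero_ne_top).comp herr).const_sub 1).const_mul _
  have hinv : Tendsto (fun n : ℕ => 1 / 2 * Real.log (1 + ((P₁ : ℝ) + P₂) / N)
      + Real.log 2 / n) atTop (𝓝 (1 / 2 * Real.log (1 + ((P₁ : ℝ) + P₂) / N) + 0)) :=
    (tendsto_const_div_atTop_nhds_zero_nat _).const_add _
  have hle : ∀ᶠ n in atTop, (R.1 + R.2 - ε) * (1 - ((c n).errorProb N).toReal)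
      ≤ 1 / 2 * Real.log (1 + ((P₁ : ℝ) + P₂) / N) + Real.log 2 / n := by
    filter_upwards [hc, eventually_gt_atTop 0] with n ⟨hadm, h₁, h₂⟩ hn
    have hn' : (0 : ℝ) < n := by exact_mod_cast hn
    have := (c n).isProbabilityMeasure_law N
    have hp : ((c n).errorProb N).toReal ≤ 1 := measureReal_le_one
    have hfano := (c n).log_size_mul_le hN hn hadm
    have hs₁ : ((c n).size₁ : ℝ) ≠ 0 := by exact_mod_cast (c n).size₁_pos.ne'
    have hs₂ : ((c n).size₂ : ℝ) ≠ 0 := by exact_mod_cast (c n).size₂_pos.ne'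
    rw [Real.log_mul hs₁ hs₂] at hfano
    unfold NoFeedbackCode.rate₁ at h₁
    unfold NoFeedbackCode.rate₂ at h₂
    have hrate : R.1 + R.2 - ε ≤ (Real.log (c n).size₁ + Real.log (c n).size₂) / n := by
      rw [add_div]
      rw [one_div_mul_eq_div] at h₁ h₂
      linarith
    refine (mul_le_mul_of_nonneg_right hrate (sub_nonneg.2 hp)).trans ?_
    rw [div_mul_eq_mul_div, div_le_iff₀ hn']
    refine hfano.trans (le_of_eq ?_)
    field_simp
  have := le_of_tendsto_of_tendsto herr' hinv hle
  linarith

/-! ### A linear feedback scheme with blocks of two channel uses -/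

/-- Coefficients of a linear scheme over two channel uses: Transmitter 1 sends `a₁` and then
`α a₁ + α' a₂`; Transmitter 2 sends `b₁` and then `-β b₁ + γ b₂ + κ (V - b₁)`, where `V` is the
feedback output of the first use. -/
structure LinearScheme where
  /-- Weight of the first symbol of Transmitter 1 in the second use. -/
  α : ℝ
  /-- Weight of the second symbol of Transmitter 1 in the second use. -/
  α' : ℝ
  /-- Negative weight of the first symbol of Transmitter 2 in the second use. -/
  β : ℝ
  /-- Weight of the second symbol of Transmitter 2 in the second use. -/
  γ : ℝ
  /-- Weight of the feedback in the second use. -/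
  κ : ℝ

namespace LinearScheme

variable (s : LinearScheme)

/-- Second input of Transmitter 1. -/
def second₁ (a : ℝ × ℝ) : ℝ := s.α * a.1 + s.α' * a.2

/-- Second input of Transmitter 2, given the first feedback output. -/
def second₂ (b : ℝ × ℝ) (v : ℝ) : ℝ := -s.β * b.1 + s.γ * b.2 + s.κ * (v - b.1)

/-- The two channel outputs; `e = (z₁, z₂, w₁)`. -/
def channel (a b : ℝ × ℝ) (e : ℝ × (ℝ × ℝ)) : ℝ × ℝ :=
  (a.1 + b.1 + e.1, s.second₁ a + s.second₂ b (a.1 + b.1 + e.1 + e.2.2) + e.2.1)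

/-- Energy used by Transmitter 1 in a block. -/
def energy₁ (q : (ℝ × ℝ) × ((ℝ × ℝ) × (ℝ × (ℝ × ℝ)))) : ℝ := q.1.1 ^ 2 + s.second₁ q.1 ^ 2

/-- Energy used by Transmitter 2 in a block. -/
def energy₂ (q : (ℝ × ℝ) × ((ℝ × ℝ) × (ℝ × (ℝ × ℝ)))) : ℝ :=
  q.2.1.1 ^ 2 + s.second₂ q.2.1 (q.1.1 + q.2.1.1 + q.2.2.1 + q.2.2.2.2) ^ 2

/-- The noise in the second output, after subtraction of everything known to a genie. -/
def residual (q : (ℝ × ℝ) × ((ℝ × ℝ) × (ℝ × ℝ))) : ℝ :=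
  q.2.2.2 - s.second₁ q.1 - s.second₂ q.2.1 q.2.2.1

/-- Variance of the residual noise. -/
def residualVar (N σsq : ℝ≥0) : ℝ := N + s.κ ^ 2 * σsq

/-- Variance of the second output. -/
def outputVar (Q₁ Q₂ N σsq : ℝ≥0) : ℝ :=
  ((s.α + s.κ) ^ 2 * Q₁ + s.α' ^ 2 * Q₁)
    + ((s.β ^ 2 * Q₂ + s.γ ^ 2 * Q₂) + (s.κ ^ 2 * N + (N + s.κ ^ 2 * σsq)))

/-- Logarithm of the channel density. -/
noncomputable def logChannel (N σsq : ℝ≥0) (q : (ℝ × ℝ) × ((ℝ × ℝ) × (ℝ × ℝ))) : ℝ :=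
  logDensity N (q.2.2.1 - q.1.1 - q.2.1.1) + logDensity (s.residualVar N σsq) (s.residual q)

/-- Information density of the message of Transmitter 1, given that of Transmitter 2. -/
noncomputable def info₁ (Q₁ N σsq : ℝ≥0) (q : (ℝ × ℝ) × ((ℝ × ℝ) × (ℝ × ℝ))) : ℝ :=
  s.logChannel N σsq q - logDensity (N + Q₁) (q.2.2.1 - q.2.1.1)
    - logDensity (s.residualVar N σsq + s.α' ^ 2 * Q₁) (s.residual q + s.α' * q.1.2)

/-- Information density of the message of Transmitter 2, given that of Transmitter 1. -/
noncomputable def info₂ (Q₂ N σsq : ℝ≥0) (q : (ℝ × ℝ) × ((ℝ × ℝ) × (ℝ × ℝ))) : ℝ :=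
  s.logChannel N σsq q - logDensity (N + Q₂) (q.2.2.1 - q.1.1)
    - logDensity (s.residualVar N σsq + s.γ ^ 2 * Q₂) (s.residual q + s.γ * q.2.1.2)

/-- Information density of the pair of messages. -/
noncomputable def info (Q₁ Q₂ N σsq : ℝ≥0) (q : (ℝ × ℝ) × ((ℝ × ℝ) × (ℝ × ℝ))) : ℝ :=
  s.logChannel N σsq q - logDensity (Q₁ + Q₂ + N) q.2.2.1
    - logDensity (s.outputVar Q₁ Q₂ N σsq) q.2.2.2

theorem measurable_channel :
    Measurable fun q : (ℝ × ℝ) × ((ℝ × ℝ) × (ℝ × (ℝ × ℝ))) => s.channel q.1 q.2.1 q.2.2 := by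
  unfold channel second₁ second₂; fun_prop

theorem measurable_energy₁ : Measurable s.energy₁ := by
  unfold energy₁ second₁; fun_prop

theorem measurable_energy₂ : Measurable s.energy₂ := by
  unfold energy₂ second₂; fun_prop

theorem measurable_info₁ (Q₁ N σsq : ℝ≥0) : Measurable (s.info₁ Q₁ N σsq) := by
  unfold info₁ logChannel residual second₁ second₂ logDensity; fun_prop

theorem measurable_info₂ (Q₂ N σsq : ℝ≥0) : Measurable (s.info₂ Q₂ N σsq) := by
  unfold info₂ logChannel residual second₁ second₂ logDensity; fun_prop

theorem measurable_info (Q₁ Q₂ N σsq : ℝ≥0) : Measurable (s.info Q₁ Q₂ N σsq) := by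
  unfold info logChannel residual second₁ second₂ logDensity; fun_prop

theorem residualVar_pos {N : ℝ≥0} (hN : 0 < N) (σsq : ℝ≥0) : 0 < s.residualVar N σsq := by
  have : (0 : ℝ) < N := hN
  unfold residualVar; positivity

theorem outputVar_pos (Q₁ Q₂ : ℝ≥0) {N : ℝ≥0} (hN : 0 < N) (σsq : ℝ≥0) :
    0 < s.outputVar Q₁ Q₂ N σsq := by
  have : (0 : ℝ) < N := hN
  unfold outputVar; positivity

/-- The law of a pair of independent centred Gaussian symbols. -/
noncomputable abbrev symbolLaw (Q : ℝ≥0) : Measure (ℝ × ℝ) :=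
  (gaussianReal 0 Q).prod (gaussianReal 0 Q)

/-- The law of the noise in a block. -/
noncomputable abbrev blockNoiseLaw (N σsq : ℝ≥0) : Measure (ℝ × (ℝ × ℝ)) :=
  (gaussianReal 0 N).prod ((gaussianReal 0 N).prod (gaussianReal 0 σsq))

/-- The reference law for y₂ may know a₁ as well as b and y₁, since `residual + α' a₂` is free of a₂
but not of a₁. Averaging over a₂ therefore cancels the y₂ terms, and averaging over a₁ the y₁ terms.
Such a score drops what y₂ tells about a₁ given b and y₁; the slack in the individual rate bounds
makes this harmless. -/
theorem lintegral_exp_info₁ {Q₁ N : ℝ≥0} (hQ₁ : 0 < Q₁) (hN : 0 < N) (σsq : ℝ≥0)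
    (b y : ℝ × ℝ) :
    ∫⁻ a, ENNReal.ofReal (Real.exp (s.info₁ Q₁ N σsq (a, b, y))) ∂symbolLaw Q₁ = 1 := by
  have hV := s.residualVar_pos hN σsq
  have hN' : (0 : ℝ) < N := hN
  have hm : Measurable fun a : ℝ × ℝ => s.info₁ Q₁ N σsq (a, b, y) :=
    (s.measurable_info₁ Q₁ N σsq).comp measurable_prodMk_right
  rw [lintegral_prod _ hm.exp.ennreal_ofReal.aemeasurable]
  have hin : ∀ a₁ : ℝ, ∫⁻ a₂, ENNReal.ofReal (Real.exp (s.info₁ Q₁ N σsq ((a₁, a₂), b, y)))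
      ∂gaussianReal 0 Q₁ = ENNReal.ofReal (Real.exp (-logDensity (N + Q₁) (y.1 - b.1)
        + logDensity N (y.1 - b.1 - 1 * a₁))) := by
    intro a₁
    have h := lintegral_gaussianReal_conv hV hQ₁ s.α' 0 (y.2 - s.α * a₁ - s.second₂ b y.1)
      (-logDensity (N + Q₁) (y.1 - b.1) + logDensity N (y.1 - b.1 - 1 * a₁)
        - logDensity (s.residualVar N σsq + s.α' ^ 2 * Q₁) (y.2 - s.α * a₁ - s.second₂ b y.1))
    rw [mul_zero, sub_zero, sub_add_cancel] at h
    rw [← h]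
    refine lintegral_congr fun a₂ => ?_
    have e₁ : s.residual ((a₁, a₂), b, y) = y.2 - s.α * a₁ - s.second₂ b y.1 - s.α' * a₂ := by
      simp only [residual, second₁]; ring
    have e₂ : y.1 - a₁ - b.1 = y.1 - b.1 - 1 * a₁ := by ring
    simp only [info₁, logChannel, e₁, e₂, sub_add_cancel]
    congr 2
    ring
  simp only [hin]
  rw [lintegral_gaussianReal_conv hN' hQ₁]
  simp

theorem lintegral_exp_info₂ {Q₂ N : ℝ≥0} (hQ₂ : 0 < Q₂) (hN : 0 < N) (σsq : ℝ≥0)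
    (a y : ℝ × ℝ) :
    ∫⁻ b, ENNReal.ofReal (Real.exp (s.info₂ Q₂ N σsq (a, b, y))) ∂symbolLaw Q₂ = 1 := by
  have hV := s.residualVar_pos hN σsq
  have hN' : (0 : ℝ) < N := hN
  have hm : Measurable fun b : ℝ × ℝ => s.info₂ Q₂ N σsq (a, b, y) :=
    (s.measurable_info₂ Q₂ N σsq).comp
      (f := fun b : ℝ × ℝ => (a, b, y)) (by fun_prop)
  rw [lintegral_prod _ hm.exp.ennreal_ofReal.aemeasurable]
  have hin : ∀ b₁ : ℝ, ∫⁻ b₂, ENNReal.ofReal (Real.exp (s.info₂ Q₂ N σsq (a, (b₁, b₂), y)))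
      ∂gaussianReal 0 Q₂ = ENNReal.ofReal (Real.exp (-logDensity (N + Q₂) (y.1 - a.1)
        + logDensity N (y.1 - a.1 - 1 * b₁))) := by
    intro b₁
    have h := lintegral_gaussianReal_conv hV hQ₂ s.γ 0
      (y.2 - s.second₁ a - (-s.β * b₁ + s.κ * (y.1 - b₁)))
      (-logDensity (N + Q₂) (y.1 - a.1) + logDensity N (y.1 - a.1 - 1 * b₁)
        - logDensity (s.residualVar N σsq + s.γ ^ 2 * Q₂)
            (y.2 - s.second₁ a - (-s.β * b₁ + s.κ * (y.1 - b₁))))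
    rw [mul_zero, sub_zero, sub_add_cancel] at h
    rw [← h]
    refine lintegral_congr fun b₂ => ?_
    have e₁ : s.residual (a, (b₁, b₂), y)
        = y.2 - s.second₁ a - (-s.β * b₁ + s.κ * (y.1 - b₁)) - s.γ * b₂ := by
      simp only [residual, second₂]; ring
    simp only [info₂, logChannel, e₁, one_mul, sub_add_cancel]
    congr 2
    ring
  simp only [hin]
  rw [lintegral_gaussianReal_conv hN' hQ₂]
  simp

/-- Averaging the pair information density over the codeword of Transmitter 2. -/
theorem lintegral_exp_info_right {Q₂ N : ℝ≥0} (Q₁ : ℝ≥0) (hQ₂ : 0 < Q₂) (hN : 0 < N) (σsq : ℝ≥0)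
    (a y : ℝ × ℝ) {d V K : ℝ} (hd : d = (s.β + s.κ) * Q₂ / (N + Q₂))
    (hV : V = s.residualVar N σsq + s.γ ^ 2 * Q₂
      + (-(s.β + s.κ)) ^ 2 * (Q₂ * N / (N + 1 ^ 2 * Q₂)))
    (hK : K = -logDensity (Q₁ + Q₂ + N) y.1 - logDensity (s.outputVar Q₁ Q₂ N σsq) y.2) :
    ∫⁻ b, ENNReal.ofReal (Real.exp (s.info Q₁ Q₂ N σsq (a, b, y))) ∂symbolLaw Q₂
      = ENNReal.ofReal (Real.exp (K + logDensity (N + Q₂) (y.1 - a.1)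
        + logDensity V (y.2 - s.κ * y.1 + d * y.1 - (s.α + d) * a.1 - s.α' * a.2))) := by
  have hR := s.residualVar_pos hN σsq
  have hN' : (0 : ℝ) < N := hN
  have hQ₂' : (0 : ℝ) < Q₂ := hQ₂
  have hm : Measurable fun b : ℝ × ℝ => s.info Q₁ Q₂ N σsq (a, b, y) :=
    (s.measurable_info Q₁ Q₂ N σsq).comp (f := fun b : ℝ × ℝ => (a, b, y)) (by fun_prop)
  rw [lintegral_prod _ hm.exp.ennreal_ofReal.aemeasurable]
  have hin : ∀ b₁ : ℝ, ∫⁻ b₂, ENNReal.ofReal (Real.exp (s.info Q₁ Q₂ N σsq (a, (b₁, b₂), y)))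
      ∂gaussianReal 0 Q₂ = ENNReal.ofReal (Real.exp (K + logDensity N (y.1 - a.1 - 1 * b₁)
        + logDensity (s.residualVar N σsq + s.γ ^ 2 * Q₂)
          (y.2 - s.second₁ a - s.κ * y.1 - (-(s.β + s.κ)) * b₁))) := by
    intro b₁
    have h := lintegral_gaussianReal_conv hR hQ₂ s.γ 0
      (y.2 - s.second₁ a - s.κ * y.1 - (-(s.β + s.κ)) * b₁)
      (K + logDensity N (y.1 - a.1 - 1 * b₁))
    rw [mul_zero, sub_zero] at h
    rw [← h]
    refine lintegral_congr fun b₂ => ?_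
    have e₁ : s.residual (a, (b₁, b₂), y)
        = y.2 - s.second₁ a - s.κ * y.1 - (-(s.β + s.κ)) * b₁ - s.γ * b₂ := by
      simp only [residual, second₂]; ring
    simp only [info, logChannel, e₁, one_mul, hK]
    congr 2
    ring
  simp only [hin]
  -- Both outputs see b₁, with coefficients 1 and -(β+κ): the first output yields its posterior,
  -- which is averaged in the second. The number `d` collects the resulting regression coefficient.
  rw [lintegral_gaussianReal_conv₂ hN' (by positivity) hQ₂, ← hV]
  have e₂ : y.2 - s.second₁ a - s.κ * y.1
        - -(s.β + s.κ) * (1 * Q₂ * (y.1 - a.1) / (N + 1 ^ 2 * Q₂))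
      = y.2 - s.κ * y.1 + d * y.1 - (s.α + d) * a.1 - s.α' * a.2 := by
    simp only [second₁, hd, one_mul, one_pow]
    field_simp
    ring
  rw [e₂, one_pow, one_mul]

/-- On the left is the conditional variance of y₂ given y₁, accumulated by integrating out b₂, b₁,
a₂, a₁. The hypothesis `hβ` says that the covariance (α+κ)Q₁ - βQ₂ + κN of the outputs vanishes, so
conditioning does not reduce the variance. -/
theorem outputVar_eq {Q₁ Q₂ N : ℝ≥0} (hQ₂ : 0 < Q₂) (hN : 0 < N) (σsq : ℝ≥0)
    (hβ : s.β * Q₂ = s.α * Q₁ + s.κ * (Q₁ + N)) {d : ℝ} (hd : d = (s.β + s.κ) * Q₂ / (N + Q₂)) :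
    s.residualVar N σsq + s.γ ^ 2 * Q₂ + (-(s.β + s.κ)) ^ 2 * (Q₂ * N / (N + 1 ^ 2 * Q₂))
        + s.α' ^ 2 * Q₁ + (s.α + d) ^ 2 * (Q₁ * (N + Q₂) / (Q₁ + Q₂ + N))
      = s.outputVar Q₁ Q₂ N σsq := by
  have hN' : (0 : ℝ) < N := hN
  have hQ₂' : (0 : ℝ) < Q₂ := hQ₂
  have hβ' : s.β = (s.α * Q₁ + s.κ * (Q₁ + N)) / Q₂ := by field_simp; exact hβ
  simp only [hd, residualVar, outputVar, hβ', one_pow, one_mul]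
  field_simp
  ring

/-- Because `hβ` makes the Gaussian outputs uncorrelated, averaging the channel density over both
codewords gives the product of the two output densities subtracted in `info`. -/
theorem lintegral_exp_info {Q₁ Q₂ N : ℝ≥0} (hQ₁ : 0 < Q₁) (hQ₂ : 0 < Q₂) (hN : 0 < N) (σsq : ℝ≥0)
    (hβ : s.β * Q₂ = s.α * Q₁ + s.κ * (Q₁ + N)) (y : ℝ × ℝ) :
    ∫⁻ q, ENNReal.ofReal (Real.exp (s.info Q₁ Q₂ N σsq (q.1, q.2, y)))
      ∂(symbolLaw Q₁).prod (symbolLaw Q₂) = 1 := by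
  have hR := s.residualVar_pos hN σsq
  have hN' : (0 : ℝ) < N := hN
  have hQ₁' : (0 : ℝ) < Q₁ := hQ₁
  have hQ₂' : (0 : ℝ) < Q₂ := hQ₂
  obtain ⟨K, hK⟩ : ∃ K, K = -logDensity (Q₁ + Q₂ + N) y.1
    - logDensity (s.outputVar Q₁ Q₂ N σsq) y.2 := ⟨_, rfl⟩
  obtain ⟨d, hd⟩ : ∃ d, d = (s.β + s.κ) * Q₂ / (N + Q₂) := ⟨_, rfl⟩
  obtain ⟨V, hV⟩ : ∃ V, V = s.residualVar N σsq + s.γ ^ 2 * Q₂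
      + (-(s.β + s.κ)) ^ 2 * (Q₂ * N / (N + 1 ^ 2 * Q₂)) := ⟨_, rfl⟩
  have hVpos : 0 < V := by rw [hV]; positivity
  have hm : Measurable fun q : (ℝ × ℝ) × (ℝ × ℝ) => s.info Q₁ Q₂ N σsq (q.1, q.2, y) :=
    (s.measurable_info Q₁ Q₂ N σsq).comp
      (f := fun q : (ℝ × ℝ) × (ℝ × ℝ) => (q.1, q.2, y)) (by fun_prop)
  have hld := measurable_logDensity
  rw [lintegral_prod _ hm.exp.ennreal_ofReal.aemeasurable]
  simp only [s.lintegral_exp_info_right Q₁ hQ₂ hN σsq _ y hd hV hK]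
  rw [lintegral_prod _ (by fun_prop)]
  simp only [lintegral_gaussianReal_conv hVpos hQ₁, mul_zero, sub_zero]
  have h := lintegral_gaussianReal_conv₂ (V := N + Q₂) (W := V + s.α' ^ 2 * Q₁) (by positivity)
    (by positivity) hQ₁ 1 (s.α + d) y.1 (y.2 - s.κ * y.1 + d * y.1) K
  simp only [one_mul, one_pow] at h
  have e₃ : (N : ℝ) + Q₂ + Q₁ = Q₁ + Q₂ + N := by ring
  -- The regression of y₂ on y₁ is zero; this is `hβ` again.
  have e₅ : y.2 - s.κ * y.1 + d * y.1 - (s.α + d) * (Q₁ * y.1 / (Q₁ + Q₂ + N)) = y.2 := by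
    have hβ' : s.β = (s.α * Q₁ + s.κ * (Q₁ + N)) / Q₂ := by field_simp; exact hβ
    simp only [hd, hβ']
    field_simp
    ring
  rw [e₃, e₅, hV, s.outputVar_eq hQ₂ hN σsq hβ hd] at h
  rw [hV, h, hK, show ∀ x y : ℝ, -x - y + x + y = 0 from fun x y => by ring, Real.exp_zero,
    ENNReal.ofReal_one]

end LinearScheme

/-! ### Variances under the block law and single-block informations -/

theorem Centered.congr {X : Type*} [MeasurableSpace X] {ρ : Measure X} {f g : X → ℝ} {v w : ℝ}
    (h : Centered ρ f v) (hfg : ∀ x, f x = g x) (hvw : v = w) : Centered ρ g w := by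
  rwa [← show f = g from funext hfg, ← hvw]

theorem Centered.integral_logDensity_self {X : Type*} [MeasurableSpace X] {ρ : Measure X}
    [IsProbabilityMeasure ρ] {f : X → ℝ} {v : ℝ} (h : Centered ρ f v) (hv : 0 < v) :
    ∫ x, logDensity v (f x) ∂ρ = -(1 / 2) * (Real.log (2 * Real.pi) + Real.log v) - 1 / 2 := by
  have hpi := Real.pi_pos
  rw [h.integral_logDensity, Real.log_mul (by positivity) hv.ne']
  field_simp

/-- Each log density is averaged over a variable having exactly its variance, so the quadratic terms
are constants that cancel against those in `F`. Only a ratio of variances remains. -/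
theorem integral_sub_logDensity_sub_logDensity {X : Type*} [MeasurableSpace X] {ρ : Measure X}
    [IsProbabilityMeasure ρ] {F f g : X → ℝ} {v w n r : ℝ} (hF : Integrable F ρ)
    (hf : Centered ρ f v) (hg : Centered ρ g w) (hv : 0 < v) (hw : 0 < w) (hn : 0 < n) (hr : 0 < r)
    (hFe : ∫ x, F x ∂ρ = -Real.log (2 * Real.pi) - (Real.log n + Real.log r) / 2 - 1) :
    ∫ x, (F x - logDensity v (f x) - logDensity w (g x)) ∂ρ
      = 1 / 2 * Real.log (v * w / (n * r)) := by
  have i₁ := hf.integrable_logDensity v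
  rw [integral_sub (f := fun x => F x - logDensity v (f x)) (hF.sub i₁)
      (hg.integrable_logDensity w), integral_sub hF i₁, hFe, hf.integral_logDensity_self hv,
    hg.integral_logDensity_self hw, Real.log_div (mul_pos hv hw).ne' (mul_pos hn hr).ne',
    Real.log_mul hv.ne' hw.ne', Real.log_mul hn.ne' hr.ne']
  ring

namespace LinearScheme

variable (s : LinearScheme)

/-- The joint law of the symbols of both transmitters and the noise of a block. -/
noncomputable abbrev blockLaw (Q₁ Q₂ N σsq : ℝ≥0) :
    Measure ((ℝ × ℝ) × ((ℝ × ℝ) × (ℝ × (ℝ × ℝ)))) :=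
  (symbolLaw Q₁).prod ((symbolLaw Q₂).prod (blockNoiseLaw N σsq))

/-- All quantities of a block are linear forms in the seven independent variables a₁, a₂, b₁, b₂,
z₁, z₂, w₁, taken in this order by the coefficients. Every variance needed below is a
specialisation. -/
theorem centered_linear (Q₁ Q₂ N σsq : ℝ≥0) (c₁ c₂ c₃ c₄ c₅ c₆ c₇ : ℝ) :
    Centered (blockLaw Q₁ Q₂ N σsq)
      (fun q => (c₁ * q.1.1 + c₂ * q.1.2) + ((c₃ * q.2.1.1 + c₄ * q.2.1.2)
        + (c₅ * q.2.2.1 + (c₆ * q.2.2.2.1 + c₇ * q.2.2.2.2))))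
      ((c₁ ^ 2 * Q₁ + c₂ ^ 2 * Q₁) + ((c₃ ^ 2 * Q₂ + c₄ ^ 2 * Q₂)
        + (c₅ ^ 2 * N + (c₆ ^ 2 * N + c₇ ^ 2 * σsq)))) :=
  have h := Centered.gaussianReal
  (((h Q₁).const_mul c₁).prod ((h Q₁).const_mul c₂)).prod
    ((((h Q₂).const_mul c₃).prod ((h Q₂).const_mul c₄)).prod
      (((h N).const_mul c₅).prod (((h N).const_mul c₆).prod ((h σsq).const_mul c₇))))

variable (Q₁ Q₂ N σsq : ℝ≥0)

theorem centered_noise : Centered (blockLaw Q₁ Q₂ N σsq)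
    (fun q => (s.channel q.1 q.2.1 q.2.2).1 - q.1.1 - q.2.1.1) N :=
  (centered_linear Q₁ Q₂ N σsq 0 0 0 0 1 0 0).congr
    (fun q => by simp only [channel]; ring) (by ring)

theorem centered_residual : Centered (blockLaw Q₁ Q₂ N σsq)
    (fun q => s.residual (q.1, q.2.1, s.channel q.1 q.2.1 q.2.2)) (s.residualVar N σsq) :=
  (centered_linear Q₁ Q₂ N σsq 0 0 0 0 0 1 s.κ).congr
    (fun q => by simp only [channel, residual, second₁, second₂]; ring)
    (by simp only [residualVar]; ring)

theorem centered_first₁ : Centered (blockLaw Q₁ Q₂ N σsq)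
    (fun q => (s.channel q.1 q.2.1 q.2.2).1 - q.2.1.1) (N + Q₁) :=
  (centered_linear Q₁ Q₂ N σsq 1 0 0 0 1 0 0).congr
    (fun q => by simp only [channel]; ring) (by ring)

theorem centered_first₂ : Centered (blockLaw Q₁ Q₂ N σsq)
    (fun q => (s.channel q.1 q.2.1 q.2.2).1 - q.1.1) (N + Q₂) :=
  (centered_linear Q₁ Q₂ N σsq 0 0 1 0 1 0 0).congr
    (fun q => by simp only [channel]; ring) (by ring)

theorem centered_residual₁ : Centered (blockLaw Q₁ Q₂ N σsq)
    (fun q => s.residual (q.1, q.2.1, s.channel q.1 q.2.1 q.2.2) + s.α' * q.1.2)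
    (s.residualVar N σsq + s.α' ^ 2 * Q₁) :=
  (centered_linear Q₁ Q₂ N σsq 0 s.α' 0 0 0 1 s.κ).congr
    (fun q => by simp only [channel, residual, second₁, second₂]; ring)
    (by simp only [residualVar]; ring)

theorem centered_residual₂ : Centered (blockLaw Q₁ Q₂ N σsq)
    (fun q => s.residual (q.1, q.2.1, s.channel q.1 q.2.1 q.2.2) + s.γ * q.2.1.2)
    (s.residualVar N σsq + s.γ ^ 2 * Q₂) :=
  (centered_linear Q₁ Q₂ N σsq 0 0 0 s.γ 0 1 s.κ).congr
    (fun q => by simp only [channel, residual, second₁, second₂]; ring)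
    (by simp only [residualVar]; ring)

theorem centered_output₁ : Centered (blockLaw Q₁ Q₂ N σsq)
    (fun q => (s.channel q.1 q.2.1 q.2.2).1) (Q₁ + Q₂ + N) :=
  (centered_linear Q₁ Q₂ N σsq 1 0 1 0 1 0 0).congr
    (fun q => by simp only [channel]; ring) (by ring)

theorem centered_output₂ : Centered (blockLaw Q₁ Q₂ N σsq)
    (fun q => (s.channel q.1 q.2.1 q.2.2).2) (s.outputVar Q₁ Q₂ N σsq) :=
  (centered_linear Q₁ Q₂ N σsq (s.α + s.κ) s.α' (-s.β) s.γ s.κ 1 s.κ).congr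
    (fun q => by simp only [channel, second₁, second₂]; ring)
    (by simp only [outputVar]; ring)

theorem centered_symbol₁ : Centered (blockLaw Q₁ Q₂ N σsq) (fun q => q.1.1) Q₁ :=
  (centered_linear Q₁ Q₂ N σsq 1 0 0 0 0 0 0).congr (fun q => by ring) (by ring)

theorem centered_second₁ : Centered (blockLaw Q₁ Q₂ N σsq) (fun q => s.second₁ q.1)
    ((s.α ^ 2 + s.α' ^ 2) * Q₁) :=
  (centered_linear Q₁ Q₂ N σsq s.α s.α' 0 0 0 0 0).congr
    (fun q => by simp only [second₁]; ring) (by ring)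

theorem integrable_energy₁ : Integrable s.energy₁ (blockLaw Q₁ Q₂ N σsq) :=
  (centered_symbol₁ Q₁ Q₂ N σsq).integrable_sq.add
    (s.centered_second₁ Q₁ Q₂ N σsq).integrable_sq

theorem integral_energy₁ : ∫ q, s.energy₁ q ∂blockLaw Q₁ Q₂ N σsq
    = Q₁ + (s.α ^ 2 + s.α' ^ 2) * Q₁ := by
  have h₁ := centered_symbol₁ Q₁ Q₂ N σsq
  have h₂ := s.centered_second₁ Q₁ Q₂ N σsq
  unfold energy₁
  rw [integral_add h₁.integrable_sq h₂.integrable_sq, h₁.second, h₂.second]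

theorem centered_second₂ : Centered (blockLaw Q₁ Q₂ N σsq)
    (fun q => s.second₂ q.2.1 (q.1.1 + q.2.1.1 + q.2.2.1 + q.2.2.2.2))
    ((s.β ^ 2 + s.γ ^ 2) * Q₂ + s.κ ^ 2 * (Q₁ + N + σsq)) :=
  (centered_linear Q₁ Q₂ N σsq s.κ 0 (-s.β) s.γ s.κ 0 s.κ).congr
    (fun q => by simp only [second₂]; ring) (by ring)

theorem centered_symbol₂ : Centered (blockLaw Q₁ Q₂ N σsq) (fun q => q.2.1.1) Q₂ :=
  (centered_linear Q₁ Q₂ N σsq 0 0 1 0 0 0 0).congr (fun q => by ring) (by ring)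

theorem integrable_energy₂ : Integrable s.energy₂ (blockLaw Q₁ Q₂ N σsq) :=
  (centered_symbol₂ Q₁ Q₂ N σsq).integrable_sq.add
    (s.centered_second₂ Q₁ Q₂ N σsq).integrable_sq

theorem integral_energy₂ : ∫ q, s.energy₂ q ∂blockLaw Q₁ Q₂ N σsq
    = Q₂ + ((s.β ^ 2 + s.γ ^ 2) * Q₂ + s.κ ^ 2 * (Q₁ + N + σsq)) := by
  have h₁ := centered_symbol₂ Q₁ Q₂ N σsq
  have h₂ := s.centered_second₂ Q₁ Q₂ N σsq
  unfold energy₂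
  rw [integral_add h₁.integrable_sq h₂.integrable_sq, h₁.second, h₂.second]

theorem integrable_logChannel : Integrable
    (fun q => s.logChannel N σsq (q.1, q.2.1, s.channel q.1 q.2.1 q.2.2))
    (blockLaw Q₁ Q₂ N σsq) :=
  ((s.centered_noise Q₁ Q₂ N σsq).integrable_logDensity _).add
    ((s.centered_residual Q₁ Q₂ N σsq).integrable_logDensity _)

theorem integral_logChannel {N : ℝ≥0} (hN : 0 < N) :
    ∫ q, s.logChannel N σsq (q.1, q.2.1, s.channel q.1 q.2.1 q.2.2) ∂blockLaw Q₁ Q₂ N σsq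
      = -Real.log (2 * Real.pi) - (Real.log N + Real.log (s.residualVar N σsq)) / 2 - 1 := by
  unfold logChannel
  rw [integral_add ((s.centered_noise Q₁ Q₂ N σsq).integrable_logDensity _)
      ((s.centered_residual Q₁ Q₂ N σsq).integrable_logDensity _),
    (s.centered_noise Q₁ Q₂ N σsq).integral_logDensity_self hN,
    (s.centered_residual Q₁ Q₂ N σsq).integral_logDensity_self (s.residualVar_pos hN σsq)]
  ring

theorem integrable_info₁ : Integrable
    (fun q => s.info₁ Q₁ N σsq (q.1, q.2.1, s.channel q.1 q.2.1 q.2.2))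
    (blockLaw Q₁ Q₂ N σsq) :=
  ((s.integrable_logChannel Q₁ Q₂ N σsq).sub
    ((s.centered_first₁ Q₁ Q₂ N σsq).integrable_logDensity _)).sub
    ((s.centered_residual₁ Q₁ Q₂ N σsq).integrable_logDensity _)

theorem integrable_info₂ : Integrable
    (fun q => s.info₂ Q₂ N σsq (q.1, q.2.1, s.channel q.1 q.2.1 q.2.2))
    (blockLaw Q₁ Q₂ N σsq) :=
  ((s.integrable_logChannel Q₁ Q₂ N σsq).sub
    ((s.centered_first₂ Q₁ Q₂ N σsq).integrable_logDensity _)).sub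
    ((s.centered_residual₂ Q₁ Q₂ N σsq).integrable_logDensity _)

theorem integrable_info : Integrable
    (fun q => s.info Q₁ Q₂ N σsq (q.1, q.2.1, s.channel q.1 q.2.1 q.2.2))
    (blockLaw Q₁ Q₂ N σsq) :=
  ((s.integrable_logChannel Q₁ Q₂ N σsq).sub
    ((s.centered_output₁ Q₁ Q₂ N σsq).integrable_logDensity _)).sub
    ((s.centered_output₂ Q₁ Q₂ N σsq).integrable_logDensity _)

variable {N}

theorem integral_info₁ (hN : 0 < N) :
    ∫ q, s.info₁ Q₁ N σsq (q.1, q.2.1, s.channel q.1 q.2.1 q.2.2) ∂blockLaw Q₁ Q₂ N σsq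
      = 1 / 2 * Real.log ((N + Q₁) * (s.residualVar N σsq + s.α' ^ 2 * Q₁)
          / (N * s.residualVar N σsq)) := by
  have hN' : (0 : ℝ) < N := hN
  have hR := s.residualVar_pos hN σsq
  exact integral_sub_logDensity_sub_logDensity (s.integrable_logChannel Q₁ Q₂ N σsq)
    (s.centered_first₁ Q₁ Q₂ N σsq) (s.centered_residual₁ Q₁ Q₂ N σsq) (by positivity)
    (by positivity) hN' hR (s.integral_logChannel Q₁ Q₂ σsq hN)

theorem integral_info₂ (hN : 0 < N) :
    ∫ q, s.info₂ Q₂ N σsq (q.1, q.2.1, s.channel q.1 q.2.1 q.2.2) ∂blockLaw Q₁ Q₂ N σsq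
      = 1 / 2 * Real.log ((N + Q₂) * (s.residualVar N σsq + s.γ ^ 2 * Q₂)
          / (N * s.residualVar N σsq)) := by
  have hN' : (0 : ℝ) < N := hN
  have hR := s.residualVar_pos hN σsq
  exact integral_sub_logDensity_sub_logDensity (s.integrable_logChannel Q₁ Q₂ N σsq)
    (s.centered_first₂ Q₁ Q₂ N σsq) (s.centered_residual₂ Q₁ Q₂ N σsq) (by positivity)
    (by positivity) hN' hR (s.integral_logChannel Q₁ Q₂ σsq hN)

theorem integral_info (hN : 0 < N) :
    ∫ q, s.info Q₁ Q₂ N σsq (q.1, q.2.1, s.channel q.1 q.2.1 q.2.2) ∂blockLaw Q₁ Q₂ N σsq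
      = 1 / 2 * Real.log ((Q₁ + Q₂ + N) * s.outputVar Q₁ Q₂ N σsq
          / (N * s.residualVar N σsq)) := by
  have hN' : (0 : ℝ) < N := hN
  have hR := s.residualVar_pos hN σsq
  exact integral_sub_logDensity_sub_logDensity (s.integrable_logChannel Q₁ Q₂ N σsq)
    (s.centered_output₁ Q₁ Q₂ N σsq) (s.centered_output₂ Q₁ Q₂ N σsq) (by positivity)
    (s.outputVar_pos Q₁ Q₂ hN σsq) hN' hR (s.integral_logChannel Q₁ Q₂ σsq hN)

end LinearScheme

/-! ### Choice of the parameters -/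

/-- Nearly full power, and a small amount of feedback: the three information densities exceed the
sum capacity without feedback. -/
theorem exists_linearScheme {P₁ P₂ N : ℝ≥0} (hP₁ : 0 < P₁) (hP₂ : 0 < P₂) (hN : 0 < N)
    (σsq : ℝ≥0) :
    ∃ (s : LinearScheme) (Q₁ Q₂ : ℝ≥0), 0 < Q₁ ∧ 0 < Q₂ ∧
      s.β * Q₂ = s.α * Q₁ + s.κ * (Q₁ + N) ∧
      (Q₁ : ℝ) + (s.α ^ 2 + s.α' ^ 2) * Q₁ < 2 * P₁ ∧
      Q₂ + ((s.β ^ 2 + s.γ ^ 2) * Q₂ + s.κ ^ 2 * (Q₁ + N + σsq)) < 2 * P₂ ∧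
      (1 + ((P₁ : ℝ) + P₂) / N) ^ 2
        < (Q₁ + Q₂ + N) * s.outputVar Q₁ Q₂ N σsq / (N * s.residualVar N σsq) ∧
      (1 + ((P₁ : ℝ) + P₂) / N) ^ 2
        < (N + Q₁) * (s.residualVar N σsq + s.α' ^ 2 * Q₁) / (N * s.residualVar N σsq)
          * ((N + Q₂) * (s.residualVar N σsq + s.γ ^ 2 * Q₂) / (N * s.residualVar N σsq)) := by
  have p : (0 : ℝ) < P₁ := hP₁
  have q : (0 : ℝ) < P₂ := hP₂
  have r : (0 : ℝ) < N := hN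
  have w : (0 : ℝ) ≤ σsq := σsq.2
  set S : ℝ := P₁ + P₂ + N with hS
  have hSpos : 0 < S := by positivity
  -- The ratio κ/α. The pair information improves as soon as S c σ² < 2 P₁ N; this choice gives S c
  -- σ² < P₁ N, and the added 1 keeps it finite at σ² = 0.
  set c : ℝ := P₁ * N / (S * (σsq + 1)) with hc
  have hcpos : 0 < c := by positivity
  -- `B` is the β that decorrelates the outputs and `Γ` the γ² that spends the rest of Transmitter
  -- 2's power in the second use, both with symbol variances tP₁ and tP₂. `V` is the residual
  -- variance; `J` and `I` are the arguments of the logarithms in the summed individual informations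
  -- and in the pair information.
  let B : ℝ → ℝ → ℝ := fun ε t => (ε * (t * P₁) + c * ε * (t * P₁ + N)) / (t * P₂)
  let Γ : ℝ → ℝ → ℝ := fun ε t => 1 - B ε t ^ 2 - (c * ε) ^ 2 * (t * P₁ + N + σsq) / (t * P₂)
  let V : ℝ → ℝ := fun ε => N + (c * ε) ^ 2 * σsq
  let J : ℝ → ℝ → ℝ := fun ε t => (N + t * P₁) * (V ε + (1 - ε ^ 2) * (t * P₁)) / (N * V ε)
    * ((N + t * P₂) * (V ε + Γ ε t * (t * P₂)) / (N * V ε))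
  let I : ℝ → ℝ → ℝ := fun ε t => (t * P₁ + t * P₂ + N)
    * (t * P₁ + t * P₂ + N + 2 * ε * (c * ε) * (t * P₁)) / (N * V ε)
  have hVpos : ∀ ε, 0 < V ε := fun ε => by positivity
  have hNV : ∀ ε, (N : ℝ) * V ε ≠ 0 := fun ε => (mul_pos r (hVpos ε)).ne'
  have hcap : (1 + ((P₁ : ℝ) + P₂) / N) = S / N := by rw [hS]; field_simp; ring
  obtain ⟨ε, ⟨hΓ, hJ⟩, hε0, hε1⟩ : ∃ ε : ℝ, (0 < Γ ε 1 ∧ (S / N) ^ 2 < J ε 1) ∧ 0 < ε ∧ ε < 1 := by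
    have hcB : ContinuousAt (fun ε => B ε 1) 0 := by
      simp only [B]; fun_prop
    have hcΓ : ContinuousAt (fun ε => Γ ε 1) 0 := by
      simp only [Γ]; fun_prop
    have hcV : ContinuousAt V 0 := by
      simp only [V]; fun_prop
    have hcJ : ContinuousAt (fun ε => J ε 1) 0 := by
      simp only [J]; fun_prop (disch := exact hNV 0)
    have h1 : ∀ᶠ ε in 𝓝 (0 : ℝ), 0 < Γ ε 1 :=
      hcΓ.eventually (lt_mem_nhds (by simp [Γ, B]))
    -- Already at ε = 0 the two individual informations sum to more than the sum capacity, strictly,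
    -- so small ε is harmless by continuity.
    have h2 : ∀ᶠ ε in 𝓝 (0 : ℝ), (S / N) ^ 2 < J ε 1 := by
      refine hcJ.eventually (lt_mem_nhds ?_)
      simp only [J, Γ, B, V, hS]
      rw [div_pow, ← sub_pos]
      have : 0 < ((P₁ : ℝ) + N) ^ 2 * (P₂ + N) ^ 2 - (P₁ + P₂ + N) ^ 2 * N ^ 2 := by
        have e : ((P₁ : ℝ) + N) ^ 2 * (P₂ + N) ^ 2 - (P₁ + P₂ + N) ^ 2 * N ^ 2
            = P₁ * P₂ * (P₁ * P₂ + 2 * N * (P₁ + P₂ + N)) := by ring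
        rw [e]; positivity
      have h' : 0 < (((P₁ : ℝ) + N) ^ 2 * (P₂ + N) ^ 2 - (P₁ + P₂ + N) ^ 2 * N ^ 2) / N ^ 4 := by
        positivity
      refine h'.trans_eq ?_
      field_simp
      ring
    have h3 : ∀ᶠ ε in 𝓝[>] (0 : ℝ), (0 < Γ ε 1 ∧ (S / N) ^ 2 < J ε 1) ∧ 0 < ε ∧ ε < 1 := by
      filter_upwards [nhdsWithin_le_nhds h1, nhdsWithin_le_nhds h2, self_mem_nhdsWithin,
        nhdsWithin_le_nhds (gt_mem_nhds (zero_lt_one (α := ℝ)))] with ε a b c d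
      exact ⟨⟨a, b⟩, c, d⟩
    exact h3.exists
  -- At ε = 0 this would be an equality, so continuity is not enough here: the comparison is between
  -- the two terms of order ε².
  have hI : (S / N) ^ 2 < I ε 1 := by
    simp only [I, V, one_mul, ← hS]
    rw [div_pow, div_lt_div_iff₀ (by positivity) (mul_pos r (hVpos ε))]
    have hcS : c * (S * (σsq + 1)) = P₁ * N := by
      rw [hc]; field_simp
    have key : 0 < 2 * P₁ * N - S * c * σsq := by nlinarith [mul_pos p r, mul_pos hSpos hcpos]
    have : 0 < S * N * (ε ^ 2 * c) * (2 * P₁ * N - S * c * σsq) := by positivity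
    nlinarith
  -- The strict inequalities survive a reduction of the power by a factor t < 1, which creates the
  -- slack used when empirical energies fluctuate.
  obtain ⟨t, ⟨hΓ, hJ, hI⟩, ht0, ht1⟩ : ∃ t : ℝ, (0 < Γ ε t ∧ (S / N) ^ 2 < J ε t ∧
      (S / N) ^ 2 < I ε t) ∧ 0 < t ∧ t < 1 := by
    have hq : (1 : ℝ) * P₂ ≠ 0 := by positivity
    have hcB : ContinuousAt (fun t => B ε t) 1 := by
      simp only [B]; fun_prop (disch := exact hq)
    have hcΓ : ContinuousAt (fun t => Γ ε t) 1 := by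
      simp only [Γ]; fun_prop (disch := exact hq)
    have hcJ : ContinuousAt (fun t => J ε t) 1 := by
      simp only [J]; fun_prop (disch := exact hNV ε)
    have hcI : ContinuousAt (fun t => I ε t) 1 := by
      simp only [I]; fun_prop (disch := exact hNV ε)
    have h3 : ∀ᶠ t in 𝓝[<] (1 : ℝ), (0 < Γ ε t ∧ (S / N) ^ 2 < J ε t ∧
        (S / N) ^ 2 < I ε t) ∧ 0 < t ∧ t < 1 := by
      filter_upwards [nhdsWithin_le_nhds (hcΓ.eventually (lt_mem_nhds hΓ)),
        nhdsWithin_le_nhds (hcJ.eventually (lt_mem_nhds hJ)),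
        nhdsWithin_le_nhds (hcI.eventually (lt_mem_nhds hI)), self_mem_nhdsWithin,
        nhdsWithin_le_nhds (lt_mem_nhds (zero_lt_one (α := ℝ)))] with t a b c d e
      exact ⟨⟨a, b, c⟩, e, d⟩
    exact h3.exists
  have hα : √(1 - ε ^ 2) ^ 2 = 1 - ε ^ 2 := Real.sq_sqrt (by nlinarith)
  have hγ : √(Γ ε t) ^ 2 = Γ ε t := Real.sq_sqrt hΓ.le
  have hQ₁ : ((t.toNNReal * P₁ : ℝ≥0) : ℝ) = t * P₁ := by
    push_cast; rw [Real.coe_toNNReal _ ht0.le]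
  have hQ₂ : ((t.toNNReal * P₂ : ℝ≥0) : ℝ) = t * P₂ := by
    push_cast; rw [Real.coe_toNNReal _ ht0.le]
  have htq : t * (P₂ : ℝ) ≠ 0 := by positivity
  refine ⟨⟨ε, √(1 - ε ^ 2), B ε t, √(Γ ε t), c * ε⟩, t.toNNReal * P₁, t.toNNReal * P₂,
    mul_pos (Real.toNNReal_pos.2 ht0) hP₁, mul_pos (Real.toNNReal_pos.2 ht0) hP₂, ?_, ?_, ?_, ?_,
    ?_⟩
  · rw [hQ₁, hQ₂]
    exact div_mul_cancel₀ _ htq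
  · rw [hQ₁]
    simp only [hα]
    nlinarith
  · rw [hQ₁, hQ₂]
    simp only [hγ]
    have e : t * (P₂ : ℝ) + ((B ε t ^ 2 + Γ ε t) * (t * P₂) + (c * ε) ^ 2 * (t * P₁ + N + σsq))
        = 2 * (t * P₂) := by
      simp only [Γ]
      field_simp
      ring
    rw [e]
    nlinarith
  · rw [hcap]
    refine hI.trans_eq ?_
    simp only [I, LinearScheme.outputVar, LinearScheme.residualVar, hQ₁, hQ₂, hα, hγ]
    congr 2
    have e : Γ ε t * (t * P₂) = t * P₂ - B ε t ^ 2 * (t * P₂)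
        - (c * ε) ^ 2 * (t * P₁ + N + σsq) := by
      simp only [Γ]
      field_simp
    rw [e]
    ring
  · rw [hcap]
    refine hJ.trans_eq ?_
    simp only [J, V, LinearScheme.residualVar, hQ₁, hQ₂, hα, hγ]

/-! ### From block codes to feedback codes -/

/-- The first channel use of block `j`. -/
def firstUse {n : ℕ} (j : Fin (n / 2)) : Fin n := ⟨2 * j, by omega⟩

/-- The second channel use of block `j`. -/
def secondUse {n : ℕ} (j : Fin (n / 2)) : Fin n := ⟨2 * j + 1, by omega⟩

/-- The hypothesis concerns only the last use when `n` is odd, which belongs to no block. -/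
theorem sum_eq_sum_blocks {M : Type*} [AddCommMonoid M] {n : ℕ} {g : Fin n → M}
    (hg : ∀ t : Fin n, n / 2 ≤ t / 2 → g t = 0) :
    ∑ t, g t = ∑ j, (g (firstUse j) + g (secondUse j)) := by
  let G : ℕ → M := fun t => if h : t < n then g ⟨t, h⟩ else 0
  have h₁ : ∑ t, g t = ∑ t ∈ Finset.range n, G t := by
    rw [Finset.sum_range]
    exact Finset.sum_congr rfl fun t _ => by simp [G]
  have h₂ : ∑ j : Fin (n / 2), (g (firstUse j) + g (secondUse j))
      = ∑ j ∈ Finset.range (n / 2), (G (2 * j) + G (2 * j + 1)) := by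
    rw [Finset.sum_range]
    refine Finset.sum_congr rfl fun j _ => ?_
    have := j.2
    have e₁ : 2 * j.1 < n := by omega
    have e₂ : 2 * j.1 + 1 < n := by omega
    simp [G, e₁, e₂, firstUse, secondUse]
  have h₃ : ∀ k, ∑ t ∈ Finset.range (2 * k), G t
      = ∑ j ∈ Finset.range k, (G (2 * j) + G (2 * j + 1)) := by
    intro k
    induction k with
    | zero => simp
    | succ k ih =>
      rw [Finset.sum_range_succ _ k, ← ih, show 2 * (k + 1) = 2 * k + 1 + 1 by ring,
        Finset.sum_range_succ, Finset.sum_range_succ, add_assoc]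
  rw [h₁, h₂, ← h₃]
  refine (Finset.sum_subset (Finset.range_mono (by omega)) fun t ht ht' => ?_).symm
  have e₁ := Finset.mem_range.1 ht
  have e₂ : ¬ t < 2 * (n / 2) := fun h => ht' (Finset.mem_range.2 h)
  simp only [G, dif_pos e₁]
  exact hg _ (show n / 2 ≤ t / 2 by omega)

/-- Lower integrals are superadditive without measurability, so the power constraint can be checked
on the total energy without proving each input measurable. -/
theorem sum_lintegral_le {Ω : Type*} [MeasurableSpace Ω] (ρ : Measure Ω) {ι : Type*}
    (s : Finset ι) (f : ι → Ω → ℝ≥0∞) :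
    ∑ i ∈ s, ∫⁻ ω, f i ω ∂ρ ≤ ∫⁻ ω, ∑ i ∈ s, f i ω ∂ρ := by
  classical
  induction s using Finset.induction_on with
  | empty => simp
  | insert i s hi ih =>
    simp only [Finset.sum_insert hi]
    exact (add_le_add le_rfl ih).trans (le_lintegral_add _ _)

theorem powerConstraint_of_lintegral_sum_le {Ω : Type*} [MeasurableSpace Ω] {ρ : Measure Ω} {n : ℕ}
    (hn : 0 < n) {X : Fin n → Ω → ℝ} {P : ℝ≥0}
    (h : ∫⁻ ω, ENNReal.ofReal (∑ t, X t ω ^ 2) ∂ρ ≤ n * P) : PowerConstraint ρ X P := by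
  have hn' : (n : ℝ≥0∞) ≠ 0 := by exact_mod_cast hn.ne'
  rw [PowerConstraint, mul_comm, ← div_eq_mul_inv,
    ENNReal.div_le_iff_le_mul (Or.inl hn') (Or.inl (ENNReal.natCast_ne_top n)), mul_comm]
  refine (sum_lintegral_le ρ _ _).trans (le_trans (le_of_eq ?_) h)
  exact lintegral_congr fun ω => (ENNReal.ofReal_sum_of_nonneg fun t _ => sq_nonneg _).symm

/-- The noise of the blocks, extracted from the noise of the channel uses. -/
def blockNoise {n : ℕ} (e : (Fin n → ℝ) × (Fin n → ℝ)) (j : Fin (n / 2)) : ℝ × (ℝ × ℝ) :=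
  (e.1 (firstUse j), e.1 (secondUse j), e.2 (firstUse j))

theorem measurePreserving_blockNoise (n : ℕ) (N σsq : ℝ≥0) :
    MeasurePreserving (blockNoise (n := n)) ((noiseLaw n N).prod (noiseLaw n σsq))
      (Measure.pi fun _ => LinearScheme.blockNoiseLaw N σsq) := by
  have hf : Function.Injective (firstUse (n := n)) := fun i j h => by
    have := congrArg Fin.val h
    simp only [firstUse] at this
    exact Fin.ext (by omega)
  have hfs : Function.Injective (Sum.elim (firstUse (n := n)) secondUse) := by
    rintro (i | i) (j | j) h <;>
    · have := congrArg Fin.val h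
      simp only [firstUse, secondUse, Sum.elim_inl, Sum.elim_inr] at this
      first
        | exact congrArg _ (Fin.ext (by omega))
        | omega
  have h₁ : MeasurePreserving (fun (z : Fin n → ℝ) (j : Fin (n / 2)) => z (firstUse j))
      (noiseLaw n σsq) (Measure.pi fun _ => gaussianReal 0 σsq) :=
    ⟨by fun_prop, map_pi_precomp _ hf⟩
  have h₂ : MeasurePreserving (fun z : Fin n → ℝ =>
        ((fun j : Fin (n / 2) => z (firstUse j)), fun j : Fin (n / 2) => z (secondUse j)))
      (noiseLaw n N) ((Measure.pi fun _ => gaussianReal 0 N).prod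
        (Measure.pi fun _ => gaussianReal 0 N)) :=
    (measurePreserving_sumPiEquivProdPi
      (fun _ : Fin (n / 2) ⊕ Fin (n / 2) => gaussianReal 0 N)).comp
      (⟨by fun_prop, map_pi_precomp (gaussianReal 0 N) hfs⟩ :
        MeasurePreserving (fun (z : Fin n → ℝ) i => z (Sum.elim firstUse secondUse i))
          (noiseLaw n N) (Measure.pi fun _ => gaussianReal 0 N))
  exact (measurePreserving_zip₃ (gaussianReal 0 N) (gaussianReal 0 N) (gaussianReal 0 σsq)
    (Fin (n / 2))).comp ((measurePreserving_prodAssoc _ _ _).comp (h₂.prod h₁))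

namespace LinearScheme

variable (s : LinearScheme) {n M₁ M₂ : ℕ}

/-- The feedback code that applies the linear scheme to pairs of channel uses. -/
noncomputable def code (h₁ : 0 < M₁) (h₂ : 0 < M₂) (a : Fin M₁ → Fin (n / 2) → ℝ × ℝ)
    (b : Fin M₂ → Fin (n / 2) → ℝ × ℝ) {dec : (Fin (n / 2) → ℝ × ℝ) → Fin M₁ × Fin M₂}
    (hdec : Measurable dec) : PartialFeedbackCode n where
  size₁ := M₁
  size₂ := M₂
  size₁_pos := h₁
  size₂_pos := h₂
  enc₁ t m := if h : t.val / 2 < n / 2 then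
    (if t.val % 2 = 0 then (a m ⟨t / 2, h⟩).1 else s.second₁ (a m ⟨t / 2, h⟩)) else 0
  -- A last use outside all blocks is silent. At an odd time `t` the index `t - 1` is the first use
  -- of the same block, whose feedback is already available.
  enc₂ t m v := if h : t.val / 2 < n / 2 then
    (if h' : t.val % 2 = 0 then (b m ⟨t / 2, h⟩).1
      else s.second₂ (b m ⟨t / 2, h⟩) (v ⟨t - 1, by omega⟩)) else 0
  measurable_enc₂ t m := by
    unfold second₂
    split_ifs <;> fun_prop
  dec y := dec fun j => (y (firstUse j), y (secondUse j))
  measurable_dec := hdec.comp (by fun_prop)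

variable {h₁ : 0 < M₁} {h₂ : 0 < M₂} {a : Fin M₁ → Fin (n / 2) → ℝ × ℝ}
  {b : Fin M₂ → Fin (n / 2) → ℝ × ℝ} {dec : (Fin (n / 2) → ℝ × ℝ) → Fin M₁ × Fin M₂}
  {hdec : Measurable dec}

theorem code_input₁_first (ω : (s.code h₁ h₂ a b hdec).Outcome) (j : Fin (n / 2)) :
    (s.code h₁ h₂ a b hdec).input₁ (firstUse j) ω = (a ω.1.1 j).1 := by
  have hj : 2 * j.1 / 2 = j.1 := by omega
  simp [code, PartialFeedbackCode.input₁, firstUse, hj]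

theorem code_input₁_second (ω : (s.code h₁ h₂ a b hdec).Outcome) (j : Fin (n / 2)) :
    (s.code h₁ h₂ a b hdec).input₁ (secondUse j) ω = s.second₁ (a ω.1.1 j) := by
  have hj : (2 * j.1 + 1) / 2 = j.1 := by omega
  have hj' : (2 * j.1 + 1) % 2 = 1 := by omega
  simp [code, PartialFeedbackCode.input₁, secondUse, hj, hj']

theorem code_input₂_first (ω : (s.code h₁ h₂ a b hdec).Outcome) (j : Fin (n / 2)) :
    (s.code h₁ h₂ a b hdec).input₂ (firstUse j) ω = (b ω.1.2 j).1 := by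
  have hj : 2 * j.1 / 2 = j.1 := by omega
  simp [code, PartialFeedbackCode.input₂, firstUse, hj]

theorem code_output_first (ω : (s.code h₁ h₂ a b hdec).Outcome) (j : Fin (n / 2)) :
    (s.code h₁ h₂ a b hdec).output ω (firstUse j)
      = (s.channel (a ω.1.1 j) (b ω.1.2 j) (blockNoise ω.2 j)).1 := by
  rw [PartialFeedbackCode.output_eq, code_input₁_first, code_input₂_first]
  rfl

theorem code_input₂_second (ω : (s.code h₁ h₂ a b hdec).Outcome) (j : Fin (n / 2)) :
    (s.code h₁ h₂ a b hdec).input₂ (secondUse j) ω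
      = s.second₂ (b ω.1.2 j) ((a ω.1.1 j).1 + (b ω.1.2 j).1 + (blockNoise ω.2 j).1
          + (blockNoise ω.2 j).2.2) := by
  have hj : (2 * j.1 + 1) / 2 = j.1 := by omega
  have hj' : (2 * j.1 + 1) % 2 = 1 := by omega
  have hf : (s.code h₁ h₂ a b hdec).feedback ω (firstUse j)
      = (a ω.1.1 j).1 + (b ω.1.2 j).1 + (blockNoise ω.2 j).1 + (blockNoise ω.2 j).2.2 := by
    rw [PartialFeedbackCode.feedback, code_output_first]
    rfl
  rw [← hf]
  simp [code, PartialFeedbackCode.input₂, secondUse, hj, hj', firstUse]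

theorem code_output_second (ω : (s.code h₁ h₂ a b hdec).Outcome) (j : Fin (n / 2)) :
    (s.code h₁ h₂ a b hdec).output ω (secondUse j)
      = (s.channel (a ω.1.1 j) (b ω.1.2 j) (blockNoise ω.2 j)).2 := by
  rw [PartialFeedbackCode.output_eq, code_input₁_second, code_input₂_second]
  rfl

theorem code_sum_input₁ (ω : (s.code h₁ h₂ a b hdec).Outcome) :
    ∑ t, (s.code h₁ h₂ a b hdec).input₁ t ω ^ 2
      = ∑ j, s.energy₁ (a ω.1.1 j, b ω.1.2 j, blockNoise ω.2 j) := by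
  rw [sum_eq_sum_blocks fun t ht => ?_]
  · simp only [code_input₁_first, code_input₁_second]
    rfl
  · simp [code, PartialFeedbackCode.input₁, not_lt.2 ht]

theorem code_sum_input₂ (ω : (s.code h₁ h₂ a b hdec).Outcome) :
    ∑ t, (s.code h₁ h₂ a b hdec).input₂ t ω ^ 2
      = ∑ j, s.energy₂ (a ω.1.1 j, b ω.1.2 j, blockNoise ω.2 j) := by
  rw [sum_eq_sum_blocks fun t ht => ?_]
  · simp only [code_input₂_first, code_input₂_second]
    rfl
  · simp [code, PartialFeedbackCode.input₂, not_lt.2 ht]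

theorem measurePreserving_code (N σsq : ℝ≥0) :
    MeasurePreserving
      (fun ω : (s.code h₁ h₂ a b hdec).Outcome =>
        ((ω.1, blockNoise ω.2) : (Fin M₁ × Fin M₂) × (Fin (n / 2) → ℝ × (ℝ × ℝ))))
      ((s.code h₁ h₂ a b hdec).law N σsq)
      ((messageLaw M₁ M₂).prod (Measure.pi fun _ => blockNoiseLaw N σsq)) := by
  have := isProbabilityMeasure_messageLaw h₁ h₂
  exact (MeasurePreserving.id (messageLaw M₁ M₂)).prod (measurePreserving_blockNoise n N σsq)

theorem measurable_block {F : Type*} [MeasurableSpace F]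
    {f : (Fin M₁ × Fin M₂) × (Fin (n / 2) → ℝ × (ℝ × ℝ)) → F}
    (hf : ∀ m, Measurable fun e => f (m, e)) : Measurable f :=
  measurable_from_prod_countable_right hf

theorem measurable_channel_block (m : Fin M₁ × Fin M₂) :
    Measurable fun (e : Fin (n / 2) → ℝ × (ℝ × ℝ)) j => s.channel (a m.1 j) (b m.2 j) (e j) :=
  measurable_pi_lambda _ fun j => s.measurable_channel.comp
    (f := fun e : Fin (n / 2) → ℝ × (ℝ × ℝ) => (a m.1 j, b m.2 j, e j)) (by fun_prop)

open Classical in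
theorem code_errorProb_eq (N σsq : ℝ≥0) :
    (s.code h₁ h₂ a b hdec).errorProb N σsq
      = ∫⁻ ω, (if dec (fun j => s.channel (a ω.1.1 j) (b ω.1.2 j) (ω.2 j)) ≠ ω.1 then 1 else 0)
          ∂((messageLaw M₁ M₂).prod (Measure.pi fun _ => blockNoiseLaw N σsq)) := by
  set D : Set ((Fin M₁ × Fin M₂) × (Fin (n / 2) → ℝ × (ℝ × ℝ))) :=
    {ω | dec (fun j => s.channel (a ω.1.1 j) (b ω.1.2 j) (ω.2 j)) ≠ ω.1} with hD
  have hDm : MeasurableSet D :=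
    (measurableSet_eq_fun (measurable_block fun m => hdec.comp (s.measurable_channel_block m))
      measurable_fst).compl
  have e₁ : ∫⁻ ω, (if dec (fun j => s.channel (a ω.1.1 j) (b ω.1.2 j) (ω.2 j)) ≠ ω.1 then 1 else 0)
          ∂((messageLaw M₁ M₂).prod (Measure.pi fun _ => blockNoiseLaw N σsq))
      = ((messageLaw M₁ M₂).prod (Measure.pi fun _ => blockNoiseLaw N σsq)) D := by
    rw [← lintegral_indicator_one hDm]
    refine lintegral_congr fun ω => ?_
    simp only [hD, Set.indicator_apply, Set.mem_ofPred_eq, Pi.one_apply]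
  rw [e₁, ← (s.measurePreserving_code (h₁ := h₁) (h₂ := h₂) (a := a) (b := b) (hdec := hdec)
    N σsq).measure_preimage hDm.nullMeasurableSet]
  unfold PartialFeedbackCode.errorProb
  congr 1
  ext ω
  have hdec' : (s.code h₁ h₂ a b hdec).dec ((s.code h₁ h₂ a b hdec).output ω)
      = dec fun j => s.channel (a ω.1.1 j) (b ω.1.2 j) (blockNoise ω.2 j) := by
    change dec (fun j => _) = _
    congr 1
    funext j
    rw [code_output_first, code_output_second]
  simp only [Set.mem_ofPred_eq, Set.mem_preimage, hD, hdec']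
  exact Iff.rfl

theorem code_admissible (hn : 0 < n) {P₁ P₂ N σsq : ℝ≥0}
    (hp₁ : ∫⁻ ω, ENNReal.ofReal (∑ j, s.energy₁ (a ω.1.1 j, b ω.1.2 j, ω.2 j))
      ∂((messageLaw M₁ M₂).prod (Measure.pi fun _ => blockNoiseLaw N σsq)) ≤ n * P₁)
    (hp₂ : ∫⁻ ω, ENNReal.ofReal (∑ j, s.energy₂ (a ω.1.1 j, b ω.1.2 j, ω.2 j))
      ∂((messageLaw M₁ M₂).prod (Measure.pi fun _ => blockNoiseLaw N σsq)) ≤ n * P₂) :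
    (s.code h₁ h₂ a b hdec).Admissible P₁ P₂ N σsq := by
  have hmp := s.measurePreserving_code (h₁ := h₁) (h₂ := h₂) (a := a) (b := b) (hdec := hdec) N σsq
  have hm₁ := s.measurable_energy₁
  have hm₂ := s.measurable_energy₂
  constructor
  · refine powerConstraint_of_lintegral_sum_le hn (le_trans (le_of_eq ?_) hp₁)
    rw [← hmp.lintegral_comp (measurable_block fun m => by fun_prop)]
    exact lintegral_congr fun ω => by rw [code_sum_input₁]
  · refine powerConstraint_of_lintegral_sum_le hn (le_trans (le_of_eq ?_) hp₂)
    rw [← hmp.lintegral_comp (measurable_block fun m => by fun_prop)]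
    exact lintegral_congr fun ω => by rw [code_sum_input₂]

end LinearScheme

/-! ### Power, rates and assembly of the feedback codes -/

theorem lintegral_ofReal_le_of_average {Ω : Type*} [MeasurableSpace Ω] {ρ : Measure Ω}
    [IsProbabilityMeasure ρ] {n : ℕ} (hn : 0 < n / 2) {F : Ω → ℝ} {E : ℝ} {P : ℝ≥0} (hE : 0 ≤ E)
    (hEP : E ≤ 2 * P)
    (h : ∫⁻ ω, ‖((n / 2 : ℕ) : ℝ)⁻¹ * F ω - E‖ₑ ∂ρ ≤ ENNReal.ofReal (2 * P - E)) :
    ∫⁻ ω, ENNReal.ofReal (F ω) ∂ρ ≤ n * P := by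
  set k := n / 2
  have hk : (0 : ℝ) < k := by exact_mod_cast hn
  have hpt : ∀ ω, ENNReal.ofReal (F ω)
      ≤ (k : ℝ≥0∞) * (ENNReal.ofReal E + ‖(k : ℝ)⁻¹ * F ω - E‖ₑ) := by
    intro ω
    rw [Real.enorm_eq_ofReal_abs, ← ENNReal.ofReal_add hE (abs_nonneg _),
      ← ENNReal.ofReal_natCast, ← ENNReal.ofReal_mul hk.le]
    refine ENNReal.ofReal_le_ofReal ?_
    have h1 := le_abs_self ((k : ℝ)⁻¹ * F ω - E)
    have h2 : (k : ℝ)⁻¹ * F ω ≤ E + |(k : ℝ)⁻¹ * F ω - E| := by linarith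
    rwa [inv_mul_le_iff₀ hk] at h2
  calc ∫⁻ ω, ENNReal.ofReal (F ω) ∂ρ
      ≤ ∫⁻ ω, (k : ℝ≥0∞) * (ENNReal.ofReal E + ‖(k : ℝ)⁻¹ * F ω - E‖ₑ) ∂ρ := lintegral_mono hpt
    _ = (k : ℝ≥0∞) * (ENNReal.ofReal E + ∫⁻ ω, ‖(k : ℝ)⁻¹ * F ω - E‖ₑ ∂ρ) := by
        rw [lintegral_const_mul' _ _ (ENNReal.natCast_ne_top k),
          lintegral_add_left measurable_const]
        simp
    _ ≤ (k : ℝ≥0∞) * (ENNReal.ofReal E + ENNReal.ofReal (2 * P - E)) := by gcongr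
    _ = ((2 * k : ℕ) : ℝ≥0∞) * P := by
        rw [← ENNReal.ofReal_add hE (by linarith), add_sub_cancel,
          ENNReal.ofReal_mul (by norm_num), ENNReal.ofReal_coe_nnreal]
        push_cast
        rw [ENNReal.ofReal_ofNat]
        ring
    -- The blocks cover 2k ≤ n uses, each block having a budget of 2P.
    _ ≤ n * P := by
        gcongr
        exact Nat.mul_div_le n 2

/-- A sum rate strictly between L and min(I, I₁ + I₂) is split in the proportion I₁ : I₂, which
keeps each share below its own bound. -/
theorem exists_rates {I₁ I₂ I L : ℝ} (h₁ : 0 < I₁) (h₂ : 0 < I₂) (hL : 0 ≤ L) (h : L < I)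
    (h₁₂ : L < I₁ + I₂) :
    ∃ R₁ R₂, 0 ≤ R₁ ∧ 0 ≤ R₂ ∧ R₁ < I₁ ∧ R₂ < I₂ ∧ R₁ + R₂ < I ∧ L < R₁ + R₂ := by
  obtain ⟨T, hLT, hT⟩ := exists_between (lt_min h h₁₂)
  have hT₁ := hT.trans_le (min_le_left _ _)
  have hT₂ := hT.trans_le (min_le_right _ _)
  have hs : 0 < I₁ + I₂ := by positivity
  have hT0 : 0 ≤ T := hL.trans hLT.le
  have hr : T / (I₁ + I₂) < 1 := (div_lt_one hs).2 hT₂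
  have hsum : I₁ * (T / (I₁ + I₂)) + I₂ * (T / (I₁ + I₂)) = T := by field_simp
  exact ⟨I₁ * (T / (I₁ + I₂)), I₂ * (T / (I₁ + I₂)), by positivity, by positivity,
    mul_lt_of_lt_one_right h₁ hr, mul_lt_of_lt_one_right h₂ hr, hsum.trans_lt hT₁,
    hLT.trans_eq hsum.symm⟩

/-- A block rate R is R/2 per channel use, since n/2 blocks are coded. An unused last channel use
loses at most R/(2n), eventually less than δ. -/
theorem eventually_rate_lt {R δ : ℝ} (hR : 0 ≤ R) (hδ : 0 < δ) {M : ℕ → ℕ}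
    (hM : ∀ k : ℕ, Real.exp (k * R) ≤ M k) :
    ∀ᶠ n : ℕ in atTop, R / 2 - δ < 1 / n * Real.log (M (n / 2)) := by
  have hlim : Tendsto (fun n : ℕ => R / n) atTop (𝓝 0) := tendsto_const_div_atTop_nhds_zero_nat R
  filter_upwards [hlim.eventually (gt_mem_nhds hδ), eventually_gt_atTop 0] with n hn hn0
  have hn' : (0 : ℝ) < n := by exact_mod_cast hn0
  have hlog : ((n / 2 : ℕ) : ℝ) * R ≤ Real.log (M (n / 2)) := by
    rw [Real.le_log_iff_exp_le ((Real.exp_pos _).trans_le (hM _))]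
    exact hM _
  have hk : (n : ℝ) ≤ 2 * ((n / 2 : ℕ) : ℝ) + 1 := by
    exact_mod_cast (by omega : n ≤ 2 * (n / 2) + 1)
  rw [div_lt_iff₀ hn'] at hn
  rw [one_div_mul_eq_div, lt_div_iff₀ hn']
  nlinarith

theorem exists_mem_capacityPartialFB (P₁ P₂ N σsq : ℝ≥0) (hP₁ : 0 < P₁) (hP₂ : 0 < P₂)
    (hN : 0 < N) :
    ∃ R ∈ capacityPartialFB P₁ P₂ N σsq,
      (1 / 2 : ℝ) * Real.log (1 + ((P₁ : ℝ) + (P₂ : ℝ)) / (N : ℝ)) < R.1 + R.2 := by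
  classical
  obtain ⟨s, Q₁, Q₂, hQ₁, hQ₂, hβ, hE₁, hE₂, hI, hI₁₂⟩ := exists_linearScheme hP₁ hP₂ hN σsq
  have hN' : (0 : ℝ) < N := hN
  have hQ₁' : (0 : ℝ) < Q₁ := hQ₁
  have hQ₂' : (0 : ℝ) < Q₂ := hQ₂
  have hV := s.residualVar_pos hN σsq
  have hO := s.outputVar_pos Q₁ Q₂ hN σsq
  set D : ℝ := 1 + ((P₁ : ℝ) + (P₂ : ℝ)) / (N : ℝ) with hD
  have hD1 : 1 ≤ D := le_add_of_nonneg_right (by positivity)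
  have hlogD : Real.log (D ^ 2) = 2 * Real.log D := by rw [Real.log_pow]; norm_num
  set A₁ := (N + Q₁) * (s.residualVar N σsq + s.α' ^ 2 * Q₁) / (N * s.residualVar N σsq) with hA₁
  set A₂ := (N + Q₂) * (s.residualVar N σsq + s.γ ^ 2 * Q₂) / (N * s.residualVar N σsq) with hA₂
  have hA₁1 : 1 < A₁ := by
    rw [hA₁, one_lt_div (by positivity)]
    exact mul_lt_mul (by linarith) (le_add_of_nonneg_right (by positivity)) hV (by positivity)
  have hA₂1 : 1 < A₂ := by
    rw [hA₂, one_lt_div (by positivity)]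
    exact mul_lt_mul (by linarith) (le_add_of_nonneg_right (by positivity)) hV (by positivity)
  have hlt : Real.log D
      < 1 / 2 * Real.log ((Q₁ + Q₂ + N) * s.outputVar Q₁ Q₂ N σsq / (N * s.residualVar N σsq)) := by
    have := Real.log_lt_log (by positivity) hI
    linarith
  have hlt₁₂ : Real.log D < 1 / 2 * Real.log A₁ + 1 / 2 * Real.log A₂ := by
    have := Real.log_lt_log (by positivity) hI₁₂
    rw [Real.log_mul (by positivity) (by positivity)] at this
    linarith
  obtain ⟨R₁, R₂, hR₁, hR₂, hRI₁, hRI₂, hRI, hsum⟩ := exists_rates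
    (mul_pos one_half_pos (Real.log_pos hA₁1)) (mul_pos one_half_pos (Real.log_pos hA₂1))
    (Real.log_nonneg hD1) hlt hlt₁₂
  rw [hA₁, ← s.integral_info₁ Q₁ Q₂ σsq hN] at hRI₁
  rw [hA₂, ← s.integral_info₂ Q₁ Q₂ σsq hN] at hRI₂
  rw [← s.integral_info Q₁ Q₂ σsq hN] at hRI
  obtain ⟨M₁, M₂, a, b, dec, hM₁, hM₂, hexp₁, hexp₂, hdec, hcost⟩ := exists_block_codes
    (LinearScheme.symbolLaw Q₁) (LinearScheme.symbolLaw Q₂) (LinearScheme.blockNoiseLaw N σsq)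
    s.measurable_channel (s.measurable_info₁ Q₁ N σsq) (s.measurable_info₂ Q₂ N σsq)
    (s.measurable_info Q₁ Q₂ N σsq)
    (fun b y => (s.lintegral_exp_info₁ hQ₁ hN σsq b y).le)
    (fun a y => (s.lintegral_exp_info₂ hQ₂ hN σsq a y).le)
    (fun y => (s.lintegral_exp_info hQ₁ hQ₂ hN σsq hβ y).le)
    (s.integrable_info₁ Q₁ Q₂ N σsq) (s.integrable_info₂ Q₁ Q₂ N σsq)
    (s.integrable_info Q₁ Q₂ N σsq) s.measurable_energy₁ s.measurable_energy₂
    (s.integrable_energy₁ Q₁ Q₂ N σsq) (s.integrable_energy₂ Q₁ Q₂ N σsq)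
    hR₁ hR₂ hRI₁ hRI₂ hRI
  rw [s.integral_energy₁, s.integral_energy₂] at hcost
  set E₁ : ℝ := Q₁ + (s.α ^ 2 + s.α' ^ 2) * Q₁
  set E₂ : ℝ := Q₂ + ((s.β ^ 2 + s.γ ^ 2) * Q₂ + s.κ ^ 2 * (Q₁ + N + σsq))
  have hhalf : Tendsto (fun n : ℕ => n / 2) atTop atTop := Nat.tendsto_div_const_atTop two_ne_zero
  have hcost' := hcost.comp hhalf
  -- The same codes serve every δ, since their rates are asymptotically at least R₁/2 and R₂/2.
  let c : (n : ℕ) → PartialFeedbackCode n := fun n =>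
    s.code (hM₁ (n / 2)) (hM₂ (n / 2)) (a (n / 2)) (b (n / 2)) (hdec (n / 2))
  refine ⟨(R₁ / 2, R₂ / 2), ⟨by positivity, by positivity, fun δ hδ => ⟨c, ?_, ?_⟩⟩, ?_⟩
  · have hpos₁ : (0 : ℝ≥0∞) < ENNReal.ofReal (2 * P₁ - E₁) :=
      ENNReal.ofReal_pos.2 (sub_pos.2 hE₁)
    have hpos₂ : (0 : ℝ≥0∞) < ENNReal.ofReal (2 * P₂ - E₂) :=
      ENNReal.ofReal_pos.2 (sub_pos.2 hE₂)
    -- The vanishing cost dominates each energy deviation, so it eventually falls below both power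
    -- slacks; the same cost also dominates the error probability.
    filter_upwards [hcost'.eventually (gt_mem_nhds hpos₁), hcost'.eventually (gt_mem_nhds hpos₂),
      hhalf.eventually (eventually_gt_atTop 0), eventually_rate_lt hR₁ hδ hexp₁,
      eventually_rate_lt hR₂ hδ hexp₂] with n hc₁ hc₂ hn hr₁ hr₂
    have := isProbabilityMeasure_messageLaw (hM₁ (n / 2)) (hM₂ (n / 2))
    refine ⟨s.code_admissible (by omega) ?_ ?_, hr₁, hr₂⟩
    · refine lintegral_ofReal_le_of_average hn (E := E₁) (by positivity) hE₁.le ?_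
      exact (lintegral_mono fun ω => le_add_left le_self_add).trans hc₁.le
    · refine lintegral_ofReal_le_of_average hn (E := E₂) (by positivity) hE₂.le ?_
      exact (lintegral_mono fun ω => le_add_left le_add_self).trans hc₂.le
  · refine tendsto_of_tendsto_of_tendsto_of_le_of_le tendsto_const_nhds hcost'
      (fun _ => zero_le) fun n => ?_
    simp only [c, LinearScheme.code_errorProb_eq]
    exact lintegral_mono fun ω => le_self_add
  · change 1 / 2 * Real.log D < R₁ / 2 + R₂ / 2
    linarith

end GaussianMAC

theorem mainTheorem2 (P₁ P₂ N σsq : ℝ≥0) (hP₁ : 0 < P₁) (hP₂ : 0 < P₂) (hN : 0 < N) :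
    GaussianMAC.capacityMAC P₁ P₂ N ⊂ GaussianMAC.capacityPartialFB P₁ P₂ N σsq ∧
    ∃ R ∈ GaussianMAC.capacityPartialFB P₁ P₂ N σsq,
      (1 / 2 : ℝ) * Real.log (1 + ((P₁ : ℝ) + (P₂ : ℝ)) / (N : ℝ)) < R.1 + R.2 := by
  obtain ⟨R, hR, hlt⟩ := GaussianMAC.exists_mem_capacityPartialFB P₁ P₂ N σsq hP₁ hP₂ hN
  exact ⟨⟨GaussianMAC.capacityMAC_subset_capacityPartialFB P₁ P₂ N σsq, fun h =>
    absurd (GaussianMAC.add_le_of_mem_capacityMAC hN (h hR)) (not_le.2 hlt)⟩, R, hR, hlt⟩
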